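/- All graphs are finite and simplicial (no loops, no multiple edges). For a graph $\Gamma$, the right-angled Artin group $A_\Gamma$ is the group generated by the vertices of $\Gamma$, subject to the relations $[a,b]=1$ for every edge $\{a,b\}$ of $\Gamma$. For a vertex $v$, let $\mathrm{st}(v)$ be the set consisting of $v$ and all vertices adjacent to $v$. If $C$ is the vertex set of a (possibly empty) union of connected components of the induced subgraph $\Gamma\setminus\mathrm{st}(v)$, the partial conjugation $P_C^v$ is the automorphism of $A_\Gamma$ sending each vertex $w\in C$ to $vwv^{-1}$ and fixing every other vertex. An automorphism of $A_\Gamma$ is conjugating if it sends each vertex $v$ (viewed as a standard generator) to a conjugate of $v$. A covering map of graphs $\varphi:\Lambda\to\Gamma$ is a graph map, surjective on vertices, that restricts for each vertex $u$ of $\Lambda$ to a bijection from the vertices adjacent to $u$ onto the vertices adjacent to $\varphi(u)$. It is regular if, whenever $\varphi(u_1)=\varphi(u_2)$, there is a graph automorphism $\sigma$ of $\Lambda$ with $\varphi\circ\sigma=\varphi$ and $\sigma(u_1)=u_2$. Let $\phi:A_\Lambda\to A_\Gamma$ be the homomorphism induced by $\varphi$. An automorphism $f$ of $A_\Gamma$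 is liftable if there is an automorphism $F$ of $A_\Lambda$ with $f\circ\phi=\phi\circ F$. Let $\mathrm{LPAut}(\varphi)\le\mathrm{Aut}(A_\Gamma)$ be the group of all liftable conjugating automorphisms. Theorem. Let $\varphi:\Lambda\to\Gamma$ be a regular covering map of finite simplicial graphs without isolated vertices (neither graph needs to be connected). Then $\mathrm{LPAut}(\varphi)$ is generated by the liftable partial conjugations, i.e. it equals the subgroup of $\mathrm{Aut}(A_\Gamma)$ generated by the partial conjugations $P_C^v$ that are liftable. -/

import Mathlib

universe u v

open scoped commutatorElement

/-- The right-angled Artin group `A_Γ`: generators are the vertices of `Γ`, relators are the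
commutators `[a, b]` over the edges `{a, b}` of `Γ`. -/
abbrev RAAG {V : Type u} (Γ : SimpleGraph V) : Type u :=
  PresentedGroup {r : FreeGroup V | ∃ a b, Γ.Adj a b ∧ r = ⁅FreeGroup.of a, FreeGroup.of b⁆}

namespace RAAG

/-- The standard generator of `A_Γ` attached to a vertex. -/
def gen {V : Type u} (Γ : SimpleGraph V) (a : V) : RAAG Γ := PresentedGroup.of a

/-- Adjacent generators commute. -/
theorem gen_commute {V : Type u} {Γ : SimpleGraph V} {a b : V} (h : Γ.Adj a b) :
    Commute (gen Γ a) (gen Γ b) := by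
  have h1 : PresentedGroup.mk
      {r : FreeGroup V | ∃ a b, Γ.Adj a b ∧ r = ⁅FreeGroup.of a, FreeGroup.of b⁆}
      ⁅FreeGroup.of a, FreeGroup.of b⁆ = 1 :=
    PresentedGroup.one_of_mem ⟨a, b, h, rfl⟩
  rw [map_commutatorElement] at h1
  exact commutatorElement_eq_one_iff_mul_comm.mp h1

/-- The universal property: a map on vertices sending adjacent vertices to commuting elements
extends to a homomorphism. -/
def lift {V : Type u} {Γ : SimpleGraph V} {G : Type v} [Group G] (f : V → G)
    (hf : ∀ a b, Γ.Adj a b → Commute (f a) (f b)) : RAAG Γ →* G :=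
  PresentedGroup.toGroup (f := f) (by
    rintro r ⟨a, b, hab, rfl⟩
    rw [map_commutatorElement, FreeGroup.lift_apply_of, FreeGroup.lift_apply_of]
    exact commutatorElement_eq_one_iff_mul_comm.mpr (hf a b hab))

theorem lift_gen {V : Type u} {Γ : SimpleGraph V} {G : Type v} [Group G] (f : V → G)
    (hf : ∀ a b, Γ.Adj a b → Commute (f a) (f b)) (a : V) : lift f hf (gen Γ a) = f a :=
  PresentedGroup.toGroup.of _

/-- The homomorphism `A_Λ → A_Γ` induced by a graph map `Λ → Γ`. -/
def map {W : Type u} {V : Type v} {Λ : SimpleGraph W} {Γ : SimpleGraph V} (p : Λ →g Γ) :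
    RAAG Λ →* RAAG Γ :=
  lift (fun w => gen Γ (p w)) (fun _ _ h => gen_commute (p.map_adj h))

/-- The (vertex set of the) star of a vertex. -/
def star {V : Type u} (Γ : SimpleGraph V) (a : V) : Set V := insert a (Γ.neighborSet a)

/-- `C` is a union of connected components of `Γ \ st(a)`, the subgraph of `Γ` induced by the
vertices outside the star of `a`. -/
def IsUnionOfComponents {V : Type u} (Γ : SimpleGraph V) (a : V) (C : Set V) : Prop :=
  ∃ S : Set (Γ.induce (star Γ a)ᶜ).ConnectedComponent, C = Subtype.val '' (⋃ K ∈ S, K.supp)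

theorem IsUnionOfComponents.notMem_star {V : Type u} {Γ : SimpleGraph V} {a : V} {C : Set V}
    (hC : IsUnionOfComponents Γ a C) {b : V} (hb : b ∈ C) : b ∉ star Γ a := by
  obtain ⟨S, rfl⟩ := hC
  obtain ⟨x, -, rfl⟩ := hb
  exact x.2

theorem IsUnionOfComponents.mem_of_adj {V : Type u} {Γ : SimpleGraph V} {a : V} {C : Set V}
    (hC : IsUnionOfComponents Γ a C) {b c : V} (hb : b ∈ C) (hbc : Γ.Adj b c)
    (hc : c ∉ star Γ a) : c ∈ C := by
  obtain ⟨S, rfl⟩ := hC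
  obtain ⟨x, hx, rfl⟩ := hb
  simp only [Set.mem_iUnion, SimpleGraph.ConnectedComponent.mem_supp_iff] at hx
  obtain ⟨K, hK, rfl⟩ := hx
  refine ⟨⟨c, hc⟩, ?_, rfl⟩
  simp only [Set.mem_iUnion, SimpleGraph.ConnectedComponent.mem_supp_iff]
  refine ⟨_, hK, SimpleGraph.ConnectedComponent.sound ?_⟩
  exact SimpleGraph.Adj.reachable (G := Γ.induce (star Γ a)ᶜ) hbc.symm

theorem IsUnionOfComponents.commute_gen {V : Type u} {Γ : SimpleGraph V} {a : V} {C : Set V}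
    (hC : IsUnionOfComponents Γ a C) {b c : V} (hb : b ∈ C) (hbc : Γ.Adj b c) (hc : c ∉ C) :
    Commute (gen Γ a) (gen Γ c) := by
  by_cases h : c ∈ star Γ a
  · rcases h with rfl | h
    · exact Commute.refl _
    · exact gen_commute h
  · exact absurd (hC.mem_of_adj hb hbc h) hc

open Classical in
/-- The endomorphism conjugating the vertices in `C` by `g` and fixing all other vertices, where `g`
commutes with every vertex outside `C` that is adjacent to a vertex in `C`. -/
noncomputable def conjHom {V : Type u} {Γ : SimpleGraph V} (C : Set V) (g : RAAG Γ)
    (hg : ∀ b c, b ∈ C → Γ.Adj b c → c ∉ C → Commute g (gen Γ c)) : RAAG Γ →* RAAG Γ :=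
  lift (fun b => if b ∈ C then g * gen Γ b * g⁻¹ else gen Γ b) (by
    intro b c hbc
    have key : ∀ b c, Γ.Adj b c → b ∈ C → c ∉ C →
        Commute (g * gen Γ b * g⁻¹) (gen Γ c) := fun b c h hb hc =>
      ((hg b c hb h hc).mul_left (gen_commute h)).mul_left (hg b c hb h hc).inv_left
    split_ifs with hb hc hc
    · exact Commute.conj_iff g |>.mpr (gen_commute hbc)
    · exact key b c hbc hb hc
    · exact (key c b hbc.symm hc hb).symm
    · exact gen_commute hbc)

theorem conjHom_gen_of_mem {V : Type u} {Γ : SimpleGraph V} (C : Set V) (g : RAAG Γ)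
    (hg : ∀ b c, b ∈ C → Γ.Adj b c → c ∉ C → Commute g (gen Γ c)) {b : V} (hb : b ∈ C) :
    conjHom C g hg (gen Γ b) = g * gen Γ b * g⁻¹ := by
  rw [conjHom, lift_gen, if_pos hb]

theorem conjHom_gen_of_notMem {V : Type u} {Γ : SimpleGraph V} (C : Set V) (g : RAAG Γ)
    (hg : ∀ b c, b ∈ C → Γ.Adj b c → c ∉ C → Commute g (gen Γ c)) {b : V} (hb : b ∉ C) :
    conjHom C g hg (gen Γ b) = gen Γ b := by
  rw [conjHom, lift_gen, if_neg hb]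

theorem conjHom_comp_conjHom {V : Type u} {Γ : SimpleGraph V} (C : Set V) (g k : RAAG Γ)
    (hg : ∀ b c, b ∈ C → Γ.Adj b c → c ∉ C → Commute g (gen Γ c))
    (hk : ∀ b c, b ∈ C → Γ.Adj b c → c ∉ C → Commute k (gen Γ c))
    (hgk : k * g = 1) (hfix : conjHom C g hg k = k) :
    (conjHom C g hg).comp (conjHom C k hk) = MonoidHom.id _ := by
  refine PresentedGroup.ext fun b => ?_
  change conjHom C g hg (conjHom C k hk (gen Γ b)) = gen Γ b
  by_cases hb : b ∈ C
  · rw [conjHom_gen_of_mem C k hk hb, map_mul, map_mul, map_inv, hfix,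
      conjHom_gen_of_mem C g hg hb, eq_inv_of_mul_eq_one_left hgk]
    group
  · rw [conjHom_gen_of_notMem C k hk hb, conjHom_gen_of_notMem C g hg hb]

/-- The partial conjugation `P_C^a`: it sends each vertex `b ∈ C` to `a b a⁻¹` and fixes all other
vertices, where `C` is a union of components of `Γ \ st(a)`. -/
noncomputable def partialConj {V : Type u} {Γ : SimpleGraph V} (a : V) (C : Set V)
    (hC : IsUnionOfComponents Γ a C) : MulAut (RAAG Γ) :=
  have ha : a ∉ C := fun h => hC.notMem_star h (Set.mem_insert _ _)
  have h1 : ∀ b c, b ∈ C → Γ.Adj b c → c ∉ C → Commute (gen Γ a) (gen Γ c) :=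
    fun _ _ hb hbc hc => hC.commute_gen hb hbc hc
  have h2 : ∀ b c, b ∈ C → Γ.Adj b c → c ∉ C → Commute (gen Γ a)⁻¹ (gen Γ c) :=
    fun b c hb hbc hc => (h1 b c hb hbc hc).inv_left
  MonoidHom.toMulEquiv (conjHom C (gen Γ a) h1) (conjHom C (gen Γ a)⁻¹ h2)
    (conjHom_comp_conjHom C _ _ h2 h1 (mul_inv_cancel _) (conjHom_gen_of_notMem C _ h2 ha))
    (conjHom_comp_conjHom C _ _ h1 h2 (inv_mul_cancel _)
      (by rw [map_inv, conjHom_gen_of_notMem C _ h1 ha]))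

/-- `f` is a partial conjugation. -/
def IsPartialConj {V : Type u} {Γ : SimpleGraph V} (f : MulAut (RAAG Γ)) : Prop :=
  ∃ (a : V) (C : Set V) (hC : IsUnionOfComponents Γ a C), f = partialConj a C hC

/-- The group of conjugating automorphisms of `A_Γ`: those sending each standard generator to a
conjugate of itself. -/
def PAut {V : Type u} (Γ : SimpleGraph V) : Subgroup (MulAut (RAAG Γ)) where
  carrier := {f | ∀ a, IsConj (gen Γ a) (f (gen Γ a))}
  one_mem' := fun a => IsConj.refl _
  mul_mem' := fun {f g} hf hg a => (hf a).trans (f.toMonoidHom.map_isConj (hg a))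
  inv_mem' := fun {f} hf a => by
    have h := (f⁻¹ : MulAut (RAAG Γ)).toMonoidHom.map_isConj (hf a)
    have e : (f⁻¹ : MulAut (RAAG Γ)).toMonoidHom (f (gen Γ a)) = gen Γ a :=
      MulAut.inv_apply_self _ f _
    rw [e] at h
    exact h.symm

/-- `F` is a lift of `f`, i.e. `f ∘ φ = φ ∘ F` where `φ : A_Λ → A_Γ` is induced by `p`. -/
def IsLift {W : Type u} {V : Type v} {Λ : SimpleGraph W} {Γ : SimpleGraph V} (p : Λ →g Γ)
    (F : MulAut (RAAG Λ)) (f : MulAut (RAAG Γ)) : Prop :=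
  ∀ x : RAAG Λ, f (map p x) = map p (F x)

/-- The group of liftable automorphisms of `A_Γ`. -/
def LAut {W : Type u} {V : Type v} {Λ : SimpleGraph W} {Γ : SimpleGraph V} (p : Λ →g Γ) :
    Subgroup (MulAut (RAAG Γ)) where
  carrier := {f | ∃ F : MulAut (RAAG Λ), IsLift p F f}
  one_mem' := ⟨1, fun _ => rfl⟩
  mul_mem' := fun {f g} ⟨F, hF⟩ ⟨G, hG⟩ => ⟨F * G, fun x => by
    rw [MulAut.mul_apply, MulAut.mul_apply, hG, hF]⟩
  inv_mem' := fun {f} ⟨F, hF⟩ => ⟨F⁻¹, fun x => by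
    have h := hF (F⁻¹ x)
    rw [MulAut.apply_inv_self] at h
    rw [← h, MulAut.inv_apply_self]⟩

/-- The group of liftable conjugating automorphisms of `A_Γ`. -/
def LPAut {W : Type u} {V : Type v} {Λ : SimpleGraph W} {Γ : SimpleGraph V} (p : Λ →g Γ) :
    Subgroup (MulAut (RAAG Γ)) :=
  LAut p ⊓ PAut Γ

/-- A covering map of graphs: a surjective graph map which restricts to a bijection from the
neighbours of each vertex `w` onto the neighbours of `p w`. -/
structure IsCovering {W : Type u} {V : Type v} {Λ : SimpleGraph W} {Γ : SimpleGraph V}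
    (p : Λ →g Γ) : Prop where
  surjective : Function.Surjective p
  bijOn : ∀ w, Set.BijOn p (Λ.neighborSet w) (Γ.neighborSet (p w))

/-- The deck transformations: graph automorphisms `σ` of `Λ` with `p ∘ σ = p`. -/
def IsDeck {W : Type u} {V : Type v} {Λ : SimpleGraph W} {Γ : SimpleGraph V} (p : Λ →g Γ)
    (σ : Λ ≃g Λ) : Prop :=
  ∀ w, p (σ w) = p w

/-- A regular covering map: the deck transformations act transitively on each fibre. -/
structure IsRegularCovering {W : Type u} {V : Type v} {Λ : SimpleGraph W} {Γ : SimpleGraph V}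
    (p : Λ →g Γ) : Prop extends IsCovering p where
  transitive : ∀ w₁ w₂, p w₁ = p w₂ → ∃ σ : Λ ≃g Λ, IsDeck p σ ∧ σ w₁ = w₂

end RAAG

/-! Two facts carry the theorem. First, conjugating automorphisms are simplified by peak reduction.
Write `f(w) = g_w w g_w⁻¹` with `g_w` as short as possible, and view `A_Γ` through its half-spaces:
the half-space at `g` labelled by a letter `s` consists of the elements `z` for which `g⁻¹z` has a
reduced word starting with `s`. If no `g_w` lies in the half-space at `g_a` labelled `a^±1` for some
`a` with `w` outside `st(a)`, then half-spaces at non-adjacent vertices are disjoint, and ping-pong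
gives `f = 1` (`eq_one_of_disjoint`). Otherwise the `w` outside `st(a)` with `g_w` in that
half-space form a union `C` of components, and composing `f` with `P_C^a` or its inverse deletes a
letter from each `g_w` with `w ∈ C` and leaves the other images unchanged (`exists_reduction`).

Second, this `P_C^a` lifts whenever `f` does (`partialConj_mem_LAut`). A lift `F` of `f` can be
corrected by a graph automorphism so as to act trivially on the abelianization
(`exists_isLift_ex_eq`). Skewering of half-spaces then shows that vertices of `Λ` connected outside
the star of every vertex over `v` have images under `f` conjugated by elements of one coset of `⟨Γ \
v⟩` (`inv_mul_mem_para_of_reachable`), and a half-space labelled `v` cannot separate elements of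
such a coset.

A component of `Λ` minus the preimage of `st(v)` straddles if it touches the links of two vertices
over `v`. By regularity any two straddling components can be connected, after a deck transformation
of one of them, outside each star over `v` (`Straddles.exists_reachOff`). So `C` contains the images
of all straddling components or of none. If none, the lift is explicit: conjugate each component by
the one vertex over `v` that it touches. If all, the complement of `C` is of the first kind and
differs from it by an inner automorphism. Induction on the total length of the minimal conjugators
finishes the proof. -/

namespace RAAG

/-! ### Pilings: a faithful record of reduced words, with an action of `A_Γ`. -/

section Piling

variable {V : Type u}

/-- A family of stacks, one for each vertex; the entry `some ε` on the stack of `v` records a letter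
`v ^ ±1`, the entry `none` a letter that neither is `v` nor commutes with `v`. -/
abbrev Stacks (V : Type u) : Type u := V → List (Option Bool)

/-- The stack of `a` carries the letter `a ^ ε` on top. -/
def HasTop (P : Stacks V) (a : V) (ε : Bool) : Prop := (P a).head? = some (some ε)

open Classical in
/-- Put the letter `a ^ ε` on the stacks. -/
noncomputable def push (Γ : SimpleGraph V) (a : V) (ε : Bool) (P : Stacks V) : Stacks V := fun w =>
  if w = a then some ε :: P w else if Γ.Adj a w then P w else none :: P w

open Classical in
/-- Remove the top entries from the stacks of all vertices that do not commute with `a`. -/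
noncomputable def pop (Γ : SimpleGraph V) (a : V) (P : Stacks V) : Stacks V := fun w =>
  if Γ.Adj a w then P w else (P w).tail

/-- The stacks that arise from reduced words. -/
inductive IsPiling (Γ : SimpleGraph V) : Stacks V → Prop
  | empty : IsPiling Γ fun _ => []
  | cons (a : V) (ε : Bool) (P : Stacks V) :
      IsPiling Γ P → ¬ HasTop P a (!ε) → IsPiling Γ (push Γ a ε P)

variable {Γ : SimpleGraph V}

theorem pop_push (a : V) (ε : Bool) (P : Stacks V) : pop Γ a (push Γ a ε P) = P := by
  funext w
  by_cases h : w = a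
  · subst h; simp [pop, push]
  · by_cases h' : Γ.Adj a w <;> simp [pop, push, h, h']

theorem hasTop_push_self (a : V) (ε : Bool) (P : Stacks V) : HasTop (push Γ a ε P) a ε := by
  simp [HasTop, push]

theorem hasTop_push_self_iff {a : V} {ε δ : Bool} {P : Stacks V} :
    HasTop (push Γ a ε P) a δ ↔ ε = δ := by
  simp [HasTop, push]

theorem hasTop_push_adj {a b : V} (h : Γ.Adj a b) (ε δ : Bool) (P : Stacks V) :
    HasTop (push Γ a ε P) b δ ↔ HasTop P b δ := by
  simp [HasTop, push, h, h.ne']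

theorem eq_or_adj_of_hasTop_push {a b : V} {ε δ : Bool} {P : Stacks V}
    (h : HasTop (push Γ a ε P) b δ) : b = a ∨ Γ.Adj a b := by
  by_contra hn
  push Not at hn
  simp [HasTop, push, hn.1, hn.2] at h

theorem push_push_comm {a b : V} (h : Γ.Adj a b) (ε δ : Bool) (P : Stacks V) :
    push Γ a ε (push Γ b δ P) = push Γ b δ (push Γ a ε P) := by
  funext w
  by_cases ha : w = a
  · subst ha; simp [push, h.ne, h.symm]
  · by_cases hb : w = b
    · subst hb; simp [push, h.ne', h]
    · by_cases ha' : Γ.Adj a w <;> by_cases hb' : Γ.Adj b w <;> simp [push, ha, hb, ha', hb']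

/-- A last letter other than `a` must be adjacent to `a`, or it would have covered the stack of `a`;
pushes of adjacent letters commute, so the letter on top can be taken as the one pushed last. -/
theorem IsPiling.exists_eq_push {P : Stacks V} (hP : IsPiling Γ P) {a : V} {ε : Bool}
    (h : HasTop P a ε) : ∃ Q, IsPiling Γ Q ∧ ¬ HasTop Q a (!ε) ∧ P = push Γ a ε Q := by
  induction hP with
  | empty => simp [HasTop] at h
  | cons b δ P hP hb ih =>
    rcases eq_or_adj_of_hasTop_push h with rfl | hab
    · rw [hasTop_push_self_iff] at h
      subst h
      exact ⟨P, hP, hb, rfl⟩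
    · obtain ⟨Q, hQ, hQa, rfl⟩ := ih ((hasTop_push_adj hab _ _ _).1 h)
      refine ⟨push Γ b δ Q, .cons b δ Q hQ ?_, ?_, push_push_comm hab _ _ _⟩
      · rwa [hasTop_push_adj hab.symm] at hb
      · rwa [hasTop_push_adj hab]

/-- The set of pilings. -/
abbrev Piling (Γ : SimpleGraph V) : Type u := {P : Stacks V // IsPiling Γ P}

open Classical in
/-- The action of the letter `a ^ ε` on stacks. -/
noncomputable def actStacks (Γ : SimpleGraph V) (a : V) (ε : Bool) (P : Stacks V) : Stacks V :=
  if HasTop P a (!ε) then pop Γ a P else push Γ a ε P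

theorem actStacks_of_not {a : V} {ε : Bool} {P : Stacks V} (h : ¬ HasTop P a (!ε)) :
    actStacks Γ a ε P = push Γ a ε P := if_neg h

theorem actStacks_push (a : V) (ε : Bool) (P : Stacks V) :
    actStacks Γ a ε (push Γ a (!ε) P) = P := by
  rw [actStacks, if_pos (hasTop_push_self _ _ _), pop_push]

theorem IsPiling.act {P : Stacks V} (hP : IsPiling Γ P) (a : V) (ε : Bool) :
    IsPiling Γ (actStacks Γ a ε P) := by
  by_cases h : HasTop P a (!ε)
  · obtain ⟨Q, hQ, -, rfl⟩ := hP.exists_eq_push h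
    rwa [actStacks_push]
  · rw [actStacks_of_not h]
    exact .cons a ε P hP h

theorem IsPiling.act_act {P : Stacks V} (hP : IsPiling Γ P) (a : V) (ε : Bool) :
    actStacks Γ a ε (actStacks Γ a (!ε) P) = P := by
  by_cases h : HasTop P a ε
  · obtain ⟨Q, hQ, hQa, rfl⟩ := hP.exists_eq_push h
    have : actStacks Γ a (!ε) (push Γ a ε Q) = Q := by
      simpa using actStacks_push (Γ := Γ) a (!ε) Q
    rw [this, actStacks_of_not hQa]
  · rw [actStacks_of_not (ε := !ε) (by simpa using h), actStacks_push]

/-- The defining relations hold for the action: adjacent letters do not affect whether the other one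
is on top, so each of the push/pop cases reduces to commuting pushes. -/
theorem IsPiling.act_comm {P : Stacks V} (hP : IsPiling Γ P) {a b : V} (h : Γ.Adj a b)
    (ε δ : Bool) :
    actStacks Γ a ε (actStacks Γ b δ P) = actStacks Γ b δ (actStacks Γ a ε P) := by
  by_cases ha : HasTop P a (!ε)
  · obtain ⟨Q, hQ, -, rfl⟩ := hP.exists_eq_push ha
    rw [actStacks_push]
    by_cases hb : HasTop Q b (!δ)
    · obtain ⟨R, -, -, rfl⟩ := hQ.exists_eq_push hb
      rw [push_push_comm h, actStacks_push, actStacks_push, actStacks_push]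
    · have hb' : ¬ HasTop (push Γ a (!ε) Q) b (!δ) := by rwa [hasTop_push_adj h]
      rw [actStacks_of_not hb, actStacks_of_not hb', push_push_comm h.symm, actStacks_push]
  · by_cases hb : HasTop P b (!δ)
    · obtain ⟨Q, hQ, -, rfl⟩ := hP.exists_eq_push hb
      rw [actStacks_push, actStacks_of_not ha, push_push_comm h, actStacks_push,
        actStacks_of_not (by rwa [hasTop_push_adj h.symm] at ha)]
    · rw [actStacks_of_not hb, actStacks_of_not ha,
        actStacks_of_not (by rwa [hasTop_push_adj h.symm]),
        actStacks_of_not (by rwa [hasTop_push_adj h]), push_push_comm h]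

/-- The generator `a` as a permutation of the pilings. -/
noncomputable def actPerm (Γ : SimpleGraph V) (a : V) : Equiv.Perm (Piling Γ) where
  toFun P := ⟨actStacks Γ a true P.1, P.2.act a true⟩
  invFun P := ⟨actStacks Γ a false P.1, P.2.act a false⟩
  left_inv P := Subtype.ext (P.2.act_act a false)
  right_inv P := Subtype.ext (P.2.act_act a true)

/-- The action of `A_Γ` on the pilings. -/
noncomputable def act (Γ : SimpleGraph V) : RAAG Γ →* Equiv.Perm (Piling Γ) :=
  lift (actPerm Γ) fun _ _ h => Equiv.ext fun P => Subtype.ext (P.2.act_comm h true true)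

end Piling

/-! ### First letters of reduced words. -/

section Starts

variable {V : Type u} {Γ : SimpleGraph V}

/-- The inverse of a letter. -/
def linv (s : V × Bool) : V × Bool := (s.1, !s.2)

@[simp] theorem linv_linv (s : V × Bool) : linv (linv s) = s := by simp [linv]

@[simp] theorem linv_fst (s : V × Bool) : (linv s).1 = s.1 := rfl

theorem linv_ne (s : V × Bool) : linv s ≠ s := by
  intro h
  have := congrArg Prod.snd h
  simp [linv] at this

/-- The element of `A_Γ` given by a letter. -/
def ltr (Γ : SimpleGraph V) (s : V × Bool) : RAAG Γ :=
  if s.2 then gen Γ s.1 else (gen Γ s.1)⁻¹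

@[simp] theorem ltr_linv (s : V × Bool) : ltr Γ (linv s) = (ltr Γ s)⁻¹ := by
  rcases s with ⟨a, _ | _⟩ <;> simp [ltr, linv]

theorem ltr_true (a : V) : ltr Γ (a, true) = gen Γ a := rfl

theorem ltr_commute {s t : V × Bool} (h : Γ.Adj s.1 t.1) : Commute (ltr Γ s) (ltr Γ t) := by
  have := gen_commute h
  rcases s with ⟨a, _ | _⟩ <;> rcases t with ⟨b, _ | _⟩ <;> simp_all [ltr]

theorem act_ltr (s : V × Bool) (P : Piling Γ) :
    (act Γ (ltr Γ s) P).1 = actStacks Γ s.1 s.2 P.1 := by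
  rcases s with ⟨a, _ | _⟩
  · simp only [ltr, Bool.false_eq_true, if_false, map_inv, act]; rfl
  · simp only [ltr, if_true, act]; rfl

/-- `g` is represented by a reduced word whose first letter is `s`. -/
def Starts (s : V × Bool) (g : RAAG Γ) : Prop :=
  HasTop (act Γ g ⟨fun _ => [], .empty⟩).1 s.1 s.2

theorem not_starts_one (s : V × Bool) : ¬ Starts s (1 : RAAG Γ) := by
  simp [Starts, HasTop]

theorem starts_ltr_mul {s : V × Bool} {g : RAAG Γ} :
    Starts s (ltr Γ s * g) ↔ ¬ Starts (linv s) g := by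
  unfold Starts
  rw [map_mul, Equiv.Perm.mul_apply, act_ltr]
  set P := act Γ g ⟨fun _ => [], .empty⟩
  simp only [linv]
  by_cases h : HasTop P.1 s.1 (!s.2)
  · obtain ⟨Q, hQ, hQa, e⟩ := P.2.exists_eq_push h
    rw [e, actStacks_push]
    simp only [Bool.not_not] at hQa
    simp [hQa, hasTop_push_self]
  · rw [actStacks_of_not h]
    simp [h, hasTop_push_self]

theorem starts_ltr_mul_of_adj {s t : V × Bool} (h : Γ.Adj t.1 s.1) {g : RAAG Γ} :
    Starts s (ltr Γ t * g) ↔ Starts s g := by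
  unfold Starts
  rw [map_mul, Equiv.Perm.mul_apply, act_ltr]
  set P := act Γ g ⟨fun _ => [], .empty⟩
  by_cases ht : HasTop P.1 t.1 (!t.2)
  · obtain ⟨Q, hQ, hQa, e⟩ := P.2.exists_eq_push ht
    rw [e, actStacks_push, hasTop_push_adj h]
  · rw [actStacks_of_not ht, hasTop_push_adj h]

/-- Put `s` last on the piling of `g`: every stack not belonging to `s` or a neighbour is then
covered by a blank. -/
theorem Starts.eq_or_adj {s t : V × Bool} {g : RAAG Γ} (hs : Starts s g) (ht : Starts t g) :
    t = s ∨ Γ.Adj s.1 t.1 := by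
  unfold Starts at hs ht
  obtain ⟨Q, hQ, hQa, e⟩ := (act Γ g ⟨fun _ => [], .empty⟩).2.exists_eq_push hs
  rw [e] at ht
  rcases eq_or_adj_of_hasTop_push ht with h | h
  · rw [h, hasTop_push_self_iff] at ht
    exact Or.inl (Prod.ext h ht.symm)
  · exact Or.inr h

end Starts

/-! ### Word length, reduced products, vertex subgroups and centralizers. -/

section Length

variable {V : Type u} {Γ : SimpleGraph V}

theorem Starts.not_linv {s : V × Bool} {g : RAAG Γ} (h : Starts s g) : ¬ Starts (linv s) g := by
  intro h'
  rcases h.eq_or_adj h' with e | e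
  · exact linv_ne s e
  · exact Γ.loopless.irrefl _ e

theorem starts_inv_ltr_mul {s : V × Bool} {g : RAAG Γ} :
    Starts (linv s) ((ltr Γ s)⁻¹ * g) ↔ ¬ Starts s g := by
  rw [← ltr_linv, starts_ltr_mul, linv_linv]

theorem starts_ltr (s : V × Bool) : Starts s (ltr Γ s) := by
  have := (starts_ltr_mul (s := s) (g := (1 : RAAG Γ))).2 (not_starts_one _)
  rwa [mul_one] at this

/-- The value of a word in `A_Γ`. -/
def wordProd (Γ : SimpleGraph V) (l : List (V × Bool)) : RAAG Γ := (l.map (ltr Γ)).prod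

@[simp] theorem wordProd_nil : wordProd Γ [] = 1 := rfl

@[simp] theorem wordProd_cons (s : V × Bool) (l : List (V × Bool)) :
    wordProd Γ (s :: l) = ltr Γ s * wordProd Γ l := by simp [wordProd]

@[simp] theorem wordProd_append (l l' : List (V × Bool)) :
    wordProd Γ (l ++ l') = wordProd Γ l * wordProd Γ l' := by simp [wordProd]

theorem closure_range_gen : Subgroup.closure (Set.range (gen Γ)) = ⊤ :=
  PresentedGroup.closure_range_of _

theorem exists_wordProd_inv (l : List (V × Bool)) :
    ∃ l' : List (V × Bool), l'.length = l.length ∧ wordProd Γ l' = (wordProd Γ l)⁻¹ := by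
  induction l with
  | nil => exact ⟨[], rfl, by simp⟩
  | cons s l ih =>
    obtain ⟨l', h1, h2⟩ := ih
    exact ⟨l' ++ [linv s], by simp [h1], by simp [h2]⟩

theorem exists_wordProd (g : RAAG Γ) : ∃ l, wordProd Γ l = g := by
  have hg : g ∈ Subgroup.closure (Set.range (gen Γ)) := by rw [closure_range_gen]; trivial
  induction hg using Subgroup.closure_induction with
  | mem x hx => obtain ⟨a, rfl⟩ := hx; exact ⟨[(a, true)], by simp [ltr_true]⟩
  | one => exact ⟨[], rfl⟩
  | mul x y _ _ hx hy =>
    obtain ⟨l, rfl⟩ := hx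
    obtain ⟨l', rfl⟩ := hy
    exact ⟨l ++ l', by simp⟩
  | inv x _ hx =>
    obtain ⟨l, rfl⟩ := hx
    obtain ⟨l', -, h⟩ := exists_wordProd_inv (Γ := Γ) l
    exact ⟨l', h⟩

/-- The word length of an element of `A_Γ`. -/
noncomputable def len (g : RAAG Γ) : ℕ := sInf {n | ∃ l, l.length = n ∧ wordProd Γ l = g}

theorem exists_word_len (g : RAAG Γ) : ∃ l, l.length = len g ∧ wordProd Γ l = g := by
  obtain ⟨l, hl⟩ := exists_wordProd g
  exact Nat.sInf_mem (s := {n | ∃ l, l.length = n ∧ wordProd Γ l = g}) ⟨_, l, rfl, hl⟩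

theorem len_wordProd_le (l : List (V × Bool)) : len (wordProd Γ l) ≤ l.length :=
  Nat.sInf_le ⟨l, rfl, rfl⟩

theorem len_mul_le (g h : RAAG Γ) : len (g * h) ≤ len g + len h := by
  obtain ⟨l, hl, rfl⟩ := exists_word_len g
  obtain ⟨l', hl', rfl⟩ := exists_word_len h
  rw [← hl, ← hl', ← wordProd_append, ← List.length_append]
  exact len_wordProd_le _

theorem len_inv_le (g : RAAG Γ) : len g⁻¹ ≤ len g := by
  obtain ⟨l, hl, rfl⟩ := exists_word_len g
  obtain ⟨l', h1, h2⟩ := exists_wordProd_inv (Γ := Γ) l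
  rw [← h2, ← hl, ← h1]
  exact len_wordProd_le _

@[simp] theorem len_inv (g : RAAG Γ) : len g⁻¹ = len g :=
  le_antisymm (len_inv_le g) (by simpa using len_inv_le g⁻¹)

@[simp] theorem len_one : len (1 : RAAG Γ) = 0 := by
  simpa using len_wordProd_le (Γ := Γ) []

theorem eq_one_of_len {g : RAAG Γ} (h : len g = 0) : g = 1 := by
  obtain ⟨l, hl, rfl⟩ := exists_word_len g
  rw [h, List.length_eq_zero_iff] at hl
  simp [hl]

theorem len_ltr_le (s : V × Bool) : len (ltr Γ s) ≤ 1 := by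
  simpa using len_wordProd_le (Γ := Γ) [s]

/-- The exchange property, which ties the piling notion of first letter to word length: a first
letter can be cancelled inside any word for the element. -/
theorem exists_shorter_word (l : List (V × Bool)) {s : V × Bool} (h : Starts s (wordProd Γ l)) :
    ∃ l' : List (V × Bool), l'.length + 1 ≤ l.length ∧
      wordProd Γ l' = (ltr Γ s)⁻¹ * wordProd Γ l := by
  induction l generalizing s with
  | nil => exact absurd h (not_starts_one s)
  | cons t l ih =>
    rw [wordProd_cons] at h ⊢
    by_cases hts : t = s
    · subst hts
      exact ⟨l, by simp, by simp⟩
    by_cases hts' : t = linv s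
    · subst hts'
      have h1 : Starts s (wordProd Γ l) := by
        by_contra hc
        have := (starts_ltr_mul (s := linv s) (g := wordProd Γ l)).2 (by simpa using hc)
        exact h.not_linv this
      obtain ⟨l', h2, h3⟩ := ih h1
      refine ⟨linv s :: l', by simpa using h2, ?_⟩
      rw [wordProd_cons, h3]
      simp
    by_cases hadj : Γ.Adj t.1 s.1
    · rw [starts_ltr_mul_of_adj hadj] at h
      obtain ⟨l', h2, h3⟩ := ih h
      refine ⟨t :: l', by simpa using h2, ?_⟩
      rw [wordProd_cons, h3, ← mul_assoc, ← mul_assoc, (ltr_commute hadj).inv_right.eq]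
    -- Here `t` cannot be a first letter alongside `s`, so it cancels against `l`. This shortens the
    -- word by two letters, which leaves room to prepend the inverse of `s`.
    · have h1 : ¬ Starts t (ltr Γ t * wordProd Γ l) := fun hc => by
        rcases hc.eq_or_adj h with e | e
        · exact hts e.symm
        · exact hadj e
      rw [starts_ltr_mul, not_not] at h1
      obtain ⟨l', h2, h3⟩ := ih h1
      refine ⟨linv s :: l', by simp; omega, ?_⟩
      rw [wordProd_cons, h3]
      simp

theorem Starts.len_inv_ltr_mul {s : V × Bool} {g : RAAG Γ} (h : Starts s g) :
    len ((ltr Γ s)⁻¹ * g) + 1 = len g := by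
  obtain ⟨l, hl, rfl⟩ := exists_word_len g
  obtain ⟨l', h1, h2⟩ := exists_shorter_word l h
  have h3 := len_wordProd_le (Γ := Γ) l'
  rw [h2] at h3
  have h4 := len_mul_le (ltr Γ s) ((ltr Γ s)⁻¹ * wordProd Γ l)
  rw [mul_inv_cancel_left] at h4
  have := len_ltr_le (Γ := Γ) s
  omega

theorem len_ltr_mul_of_not {s : V × Bool} {g : RAAG Γ} (h : ¬ Starts (linv s) g) :
    len (ltr Γ s * g) = len g + 1 := by
  have := ((starts_ltr_mul (s := s)).2 h).len_inv_ltr_mul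
  rw [inv_mul_cancel_left] at this
  omega

theorem starts_iff_len_lt {s : V × Bool} {g : RAAG Γ} :
    Starts s g ↔ len ((ltr Γ s)⁻¹ * g) < len g := by
  constructor
  · intro h
    have := h.len_inv_ltr_mul
    omega
  · intro h
    by_contra hc
    have := len_ltr_mul_of_not (s := linv s) (g := g) (by simpa using hc)
    rw [ltr_linv] at this
    omega

theorem exists_starts {g : RAAG Γ} (hg : g ≠ 1) : ∃ s, Starts s g := by
  obtain ⟨l, hl, rfl⟩ := exists_word_len g
  cases l with
  | nil => simp at hg
  | cons s l =>
    refine ⟨s, starts_iff_len_lt.2 ?_⟩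
    rw [← hl, wordProd_cons, inv_mul_cancel_left]
    have := len_wordProd_le (Γ := Γ) l
    simp; omega

/-- Induction on reduced words, from the left. -/
theorem starts_induction {motive : RAAG Γ → Prop} (one : motive 1)
    (step : ∀ s g, ¬ Starts (linv s) g → motive g → motive (ltr Γ s * g)) (g : RAAG Γ) :
    motive g := by
  induction hn : len g generalizing g with
  | zero => rw [eq_one_of_len hn]; exact one
  | succ n ih =>
    have hg : g ≠ 1 := by rintro rfl; simp at hn
    obtain ⟨s, hs⟩ := exists_starts hg
    have h1 := hs.len_inv_ltr_mul
    have h2 := step s ((ltr Γ s)⁻¹ * g) (by rw [starts_inv_ltr_mul, not_not]; exact hs)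
      (ih _ (by omega))
    rwa [mul_inv_cancel_left] at h2

/-- The product `a * b` is reduced. -/
def Red (a b : RAAG Γ) : Prop := len (a * b) = len a + len b

theorem Red.starts {a b : RAAG Γ} (h : Red a b) {s : V × Bool} (hs : Starts s a) :
    Starts s (a * b) := by
  rw [starts_iff_len_lt, h, ← mul_assoc]
  have h1 := len_mul_le ((ltr Γ s)⁻¹ * a) b
  have h2 := hs.len_inv_ltr_mul
  omega

theorem Red.symm_inv {a b : RAAG Γ} (h : Red a b) : Red b⁻¹ a⁻¹ := by
  rw [Red, ← mul_inv_rev, len_inv, len_inv, len_inv, h, add_comm]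

theorem Red.of_mul_left {a b c : RAAG Γ} (h : Red (a * b) c) (hab : Red a b) : Red b c := by
  unfold Red at *
  have h1 := len_mul_le a (b * c)
  rw [← mul_assoc] at h1
  have h2 := len_mul_le b c
  omega

theorem Red.of_mul_right {a b c : RAAG Γ} (h : Red a (b * c)) (hab : Red b c) : Red a b := by
  unfold Red at *
  have h1 := len_mul_le (a * b) c
  rw [mul_assoc] at h1
  have h2 := len_mul_le a b
  omega

theorem red_ltr_iff {s : V × Bool} {g : RAAG Γ} : Red (ltr Γ s) g ↔ ¬ Starts (linv s) g := by
  have h1 : len (ltr Γ s) = 1 := by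
    have := (starts_ltr (Γ := Γ) s).len_inv_ltr_mul
    rw [inv_mul_cancel, len_one] at this
    omega
  constructor
  · intro h hs
    have h2 := hs.len_inv_ltr_mul
    rw [ltr_linv, inv_inv] at h2
    unfold Red at h
    omega
  · intro h
    rw [Red, h1, len_ltr_mul_of_not h, add_comm]

/-- The subgroup generated by a set of vertices. -/
def para (Γ : SimpleGraph V) (S : Set V) : Subgroup (RAAG Γ) := Subgroup.closure (gen Γ '' S)

theorem gen_mem_para {S : Set V} {a : V} (h : a ∈ S) : gen Γ a ∈ para Γ S :=
  Subgroup.subset_closure ⟨a, h, rfl⟩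

theorem ltr_mem_para {S : Set V} {s : V × Bool} (h : s.1 ∈ S) : ltr Γ s ∈ para Γ S := by
  rcases s with ⟨a, _ | _⟩
  · exact inv_mem (gen_mem_para h)
  · exact gen_mem_para h

theorem para_mono {S T : Set V} (h : S ⊆ T) : para Γ S ≤ para Γ T :=
  Subgroup.closure_mono (Set.image_mono h)

theorem para_induction {S : Set V} {motive : RAAG Γ → Prop} (one : motive 1)
    (step : ∀ s : V × Bool, s.1 ∈ S → ∀ g, motive g → motive (ltr Γ s * g)) {g : RAAG Γ}
    (hg : g ∈ para Γ S) : motive g := by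
  have key : ∀ h, motive h → motive (g * h) := by
    unfold para at hg
    induction hg using Subgroup.closure_induction'' with
    | mem x hx => obtain ⟨a, ha, rfl⟩ := hx; exact step (a, true) ha
    | inv_mem x hx => obtain ⟨a, ha, rfl⟩ := hx; exact step (a, false) ha
    | one => intro h hh; rwa [one_mul]
    | mul x y _ _ hx hy => intro h hh; rw [mul_assoc]; exact hx _ (hy _ hh)
  simpa using key 1 one

theorem starts_para_mul {s : V × Bool} {y : RAAG Γ} (hy : y ∈ para Γ (Γ.neighborSet s.1))
    {g : RAAG Γ} : Starts s (y * g) ↔ Starts s g := by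
  refine para_induction (motive := fun y => Starts s (y * g) ↔ Starts s g) ?_ ?_ hy
  · rw [one_mul]
  · intro t ht h hh
    rw [mul_assoc, starts_ltr_mul_of_adj (SimpleGraph.Adj.symm ht), hh]

theorem commute_ltr_of_mem_para {s : V × Bool} {y : RAAG Γ}
    (hy : y ∈ para Γ (Γ.neighborSet s.1)) : Commute (ltr Γ s) y :=
  para_induction (motive := fun y => Commute (ltr Γ s) y) (Commute.one_right _)
    (fun _ ht _ hh => (ltr_commute ht).mul_right hh) hy

/-- A first letter of a reduced product that is not supplied by `a` comes from `b` and has to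
commute past every letter of `a`; strip `a` letter by letter. -/
theorem Red.starts_right {a b : RAAG Γ} (h : Red a b) {s : V × Bool} (hs : Starts s (a * b))
    (ha : ¬ Starts s a) : a ∈ para Γ (Γ.neighborSet s.1) ∧ Starts s b := by
  revert h hs ha
  refine starts_induction (motive := fun a => Red a b → Starts s (a * b) → ¬ Starts s a →
    a ∈ para Γ (Γ.neighborSet s.1) ∧ Starts s b) ?_ ?_ a
  · intro _ hs _
    rw [one_mul] at hs
    exact ⟨one_mem _, hs⟩
  · intro t a hta ih h hs ha
    have ht : Starts t (ltr Γ t * a) := starts_ltr_mul.2 hta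
    rcases (h.starts ht).eq_or_adj hs with rfl | hadj
    · exact absurd ht ha
    · rw [starts_ltr_mul_of_adj hadj] at ha
      rw [mul_assoc, starts_ltr_mul_of_adj hadj] at hs
      obtain ⟨h1, h2⟩ := ih (h.of_mul_left (red_ltr_iff.2 hta)) hs ha
      exact ⟨mul_mem (ltr_mem_para hadj.symm) h1, h2⟩

/-- If prepending `t` to the reduced product `a * b` cancels, the cancelled letter lies in `b` and
commutes past `a`; then the inverse of `t * a` starts with it as well. -/
theorem red_of_no_cancellation {a b : RAAG Γ}
    (h : ∀ s, Starts s a⁻¹ → ¬ Starts s b) : Red a b := by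
  revert h
  refine starts_induction (motive := fun a => (∀ s, Starts s a⁻¹ → ¬ Starts s b) → Red a b)
    ?_ ?_ a
  · intro _; simp [Red]
  · intro t a hta ih h
    have hred : Red (ltr Γ t) a := red_ltr_iff.2 hta
    have hab : Red a b := ih fun s hs => h s (by
      have := hred.symm_inv.starts hs
      rwa [← mul_inv_rev] at this)
    have key : ¬ Starts (linv t) (a * b) := by
      intro hs
      obtain ⟨h1, h2⟩ := hab.starts_right hs hta
      refine h (linv t) ?_ h2
      have hc : Commute (ltr Γ (linv t)) a := commute_ltr_of_mem_para h1
      rw [ltr_linv, Commute.inv_left_iff] at hc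
      rw [hc.eq, mul_inv_rev, ← ltr_linv, starts_ltr_mul, linv_linv]
      exact fun hc' => not_starts_one t
        ((starts_para_mul (s := t) (y := a⁻¹) (inv_mem h1)).1 (by simpa using hc'))
    have := red_ltr_iff.2 key
    unfold Red at *
    rw [mul_assoc]
    omega

theorem len_mul_ltr (g : RAAG Γ) (t : V × Bool) :
    Red g (ltr Γ t) ∨ Red (g * ltr Γ t) (ltr Γ t)⁻¹ := by
  by_cases h : Starts t g⁻¹
  · right
    have : Red (ltr Γ t) ((ltr Γ t)⁻¹ * g⁻¹) := by
      rw [red_ltr_iff, starts_inv_ltr_mul, not_not]; exact h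
    simpa using this.symm_inv
  · left
    have : Red (ltr Γ (linv t)) g⁻¹ := by rw [red_ltr_iff, linv_linv]; exact h
    simpa using this.symm_inv

theorem eq_of_starts_ltr {s t : V × Bool} (h : Starts s (ltr Γ t)) : t = s := by
  rcases (starts_ltr t).eq_or_adj h with e | e
  · exact e.symm
  · have h1 := h
    rw [← mul_one (ltr Γ t), starts_ltr_mul_of_adj e] at h1
    exact absurd h1 (not_starts_one s)

/-- The wall-crossing principle: an edge of the Cayley graph enters the half-space of `s` at the
identity only if it is labelled `s` and is a translate of the edge from `1` to `s` by an element of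
the link subgroup. -/
theorem cross {s t : V × Bool} {g : RAAG Γ} (hg : ¬ Starts s g) (hgt : Starts s (g * ltr Γ t)) :
    t = s ∧ g ∈ para Γ (Γ.neighborSet s.1) := by
  rcases len_mul_ltr g t with h | h
  · obtain ⟨h1, h2⟩ := h.starts_right hgt hg
    exact ⟨eq_of_starts_ltr h2, h1⟩
  · have := h.starts hgt
    rw [mul_inv_cancel_right] at this
    exact absurd this hg

theorem starts_mul_ltr {s t : V × Bool} (h : t.1 ≠ s.1) {g : RAAG Γ} :
    Starts s (g * ltr Γ t) ↔ Starts s g := by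
  constructor
  · intro h1
    by_contra h2
    exact h (congrArg Prod.fst (cross h2 h1).1)
  · intro h1
    by_contra h2
    have h3 : Starts s (g * ltr Γ t * ltr Γ (linv t)) := by rwa [ltr_linv, mul_inv_cancel_right]
    have h4 := congrArg Prod.fst (cross h2 h3).1
    exact h h4

theorem starts_mul_para {s : V × Bool} {S : Set V} (hs : s.1 ∉ S) {y : RAAG Γ}
    (hy : y ∈ para Γ S) (g : RAAG Γ) : Starts s (g * y) ↔ Starts s g := by
  revert g
  refine para_induction (motive := fun y => ∀ g, Starts s (g * y) ↔ Starts s g) ?_ ?_ hy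
  · simp
  · intro t ht y ih g
    rw [← mul_assoc, ih, starts_mul_ltr]
    rintro e
    exact hs (e ▸ ht)

theorem Starts.mem_of_mem_para {s : V × Bool} {S : Set V} {g : RAAG Γ} (h : Starts s g)
    (hg : g ∈ para Γ S) : s.1 ∈ S := by
  by_contra hs
  have := (starts_mul_para hs hg 1).1 (by rwa [one_mul])
  exact not_starts_one s this

/-- A first letter of `g` belongs to every `S i`, so it can be removed without leaving any of the
subgroups. -/
theorem mem_para_iInter {ι : Type*} {S : ι → Set V} {g : RAAG Γ}
    (h : ∀ i, g ∈ para Γ (S i)) : g ∈ para Γ (⋂ i, S i) := by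
  revert h
  refine starts_induction (motive := fun g => (∀ i, g ∈ para Γ (S i)) → g ∈ para Γ (⋂ i, S i))
    (fun _ => one_mem _) ?_ g
  intro s g hs ih h
  have h1 : ∀ i, s.1 ∈ S i := fun i => (starts_ltr_mul.2 hs).mem_of_mem_para (h i)
  refine mul_mem (ltr_mem_para (Set.mem_iInter.2 h1)) (ih fun i => ?_)
  have := mul_mem (inv_mem (ltr_mem_para (Γ := Γ) (h1 i))) (h i)
  rwa [inv_mul_cancel_left] at this

theorem commute_of_mem_para_star {a : V} {c : RAAG Γ} (hc : c ∈ para Γ (star Γ a)) :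
    Commute c (gen Γ a) := by
  refine para_induction (motive := fun c => Commute c (gen Γ a)) (Commute.one_left _) ?_ hc
  intro s hs g hg
  refine Commute.mul_left ?_ hg
  rcases hs with e | e
  · rcases s with ⟨b, _ | _⟩ <;> simp only at e <;> subst e <;> simp [ltr]
  · exact (ltr_commute (s := s) (t := (a, true)) (SimpleGraph.Adj.symm e))

/-- The centralizer of a standard generator is generated by the star of the vertex. -/
theorem mem_para_star_of_commute {a : V} {g : RAAG Γ} (h : Commute g (gen Γ a)) :
    g ∈ para Γ (star Γ a) := by
  induction hn : len g using Nat.strong_induction_on generalizing g with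
  | _ n ih =>
    by_cases hg : g = 1
    · rw [hg]; exact one_mem _
    by_cases hex : ∃ s, Starts s g ∧ s.1 ∈ star Γ a
    · obtain ⟨s, hs, hsa⟩ := hex
      have hc := commute_of_mem_para_star (ltr_mem_para (Γ := Γ) hsa)
      have h1 := hs.len_inv_ltr_mul
      have h2 := ih _ (by omega) (hc.inv_left.mul_left h) rfl
      have := mul_mem (ltr_mem_para hsa) h2
      rwa [mul_inv_cancel_left] at this
    -- If no first letter of `g` lies in the star, then `a * g` starts with `a`, and being equal to
    -- `g * a` it also starts with a first letter of `g`. That letter must be equal or adjacent to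
    -- `a`, a contradiction.
    · push Not at hex
      obtain ⟨s, hs⟩ := exists_starts hg
      have h1 : Starts (a, true) (gen Γ a * g) := by
        rw [← ltr_true, starts_ltr_mul]
        exact fun hc => hex _ hc (Set.mem_insert _ _)
      have hsa := hex s hs
      have h2 : Starts s (gen Γ a * g) := by
        rw [← h.eq, ← ltr_true, starts_mul_ltr]
        · exact hs
        · rintro rfl; exact hsa (Set.mem_insert _ _)
      rcases h1.eq_or_adj h2 with rfl | e
      · exact absurd (Set.mem_insert _ _) hsa
      · exact absurd (Set.mem_insert_of_mem _ e) hsa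

open Classical in
/-- The retraction of `A_Γ` onto the subgroup generated by a set of vertices. -/
noncomputable def retract (Γ : SimpleGraph V) (S : Set V) : RAAG Γ →* RAAG Γ :=
  lift (fun a => if a ∈ S then gen Γ a else 1) (by
    intro a b h
    have := gen_commute h
    split_ifs <;> simp [this])

theorem retract_gen_of_mem {S : Set V} {a : V} (h : a ∈ S) :
    retract Γ S (gen Γ a) = gen Γ a := by
  rw [retract, lift_gen, if_pos h]

theorem retract_mem (S : Set V) (g : RAAG Γ) : retract Γ S g ∈ para Γ S := by
  have hg : g ∈ Subgroup.closure (Set.range (gen Γ)) := by rw [closure_range_gen]; trivial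
  have hle : Subgroup.closure (Set.range (gen Γ)) ≤ (para Γ S).comap (retract Γ S) := by
    rw [Subgroup.closure_le]
    rintro _ ⟨a, rfl⟩
    rw [SetLike.mem_coe, Subgroup.mem_comap, retract, lift_gen]
    split_ifs with h
    · exact gen_mem_para h
    · exact one_mem _
  exact hle hg

theorem retract_of_mem {S : Set V} {g : RAAG Γ} (h : g ∈ para Γ S) : retract Γ S g = g := by
  have hle : para Γ S ≤ (retract Γ S).eqLocus (MonoidHom.id _) := by
    rw [para, Subgroup.closure_le]
    rintro _ ⟨a, ha, rfl⟩
    exact retract_gen_of_mem ha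
  exact hle h

/-- If commuting elements are conjugate to adjacent generators `a` and `b`, and `g` conjugates `a` to
the first, then some element of `g ⟨st(a)⟩` conjugates both. -/
theorem exists_common_conj {a b : V} (hab : Γ.Adj a b) {x y g : RAAG Γ}
    (hx : x = g * gen Γ a * g⁻¹) (hy : IsConj (gen Γ b) y) (h : Commute x y) :
    ∃ c ∈ para Γ (star Γ a), x = (g * c) * gen Γ a * (g * c)⁻¹ ∧
      y = (g * c) * gen Γ b * (g * c)⁻¹ := by
  have hb : b ∈ star Γ a := Set.mem_insert_of_mem _ hab
  have h1 : Commute (g⁻¹ * y * g) (gen Γ a) := by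
    have h2 : Commute (g⁻¹ * y * g⁻¹⁻¹) (g⁻¹ * x * g⁻¹⁻¹) := (Commute.conj_iff _).2 h.symm
    rw [hx] at h2
    simpa [mul_assoc] using h2
  have h2 := mem_para_star_of_commute h1
  obtain ⟨k, hk⟩ := isConj_iff.1 hy
  have h3 : g⁻¹ * y * g = (g⁻¹ * k) * gen Γ b * (g⁻¹ * k)⁻¹ := by rw [← hk]; group
  -- The conjugate `g⁻¹ * y * g` centralizes `a`, so it is fixed by the retraction onto the star
  -- subgroup; applying the retraction moves the conjugator into that subgroup.
  have h4 := congrArg (retract Γ (star Γ a)) h3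
  rw [retract_of_mem h2, map_mul, map_mul, map_inv, retract_gen_of_mem hb] at h4
  set c := retract Γ (star Γ a) (g⁻¹ * k) with hc
  have hcm : c ∈ para Γ (star Γ a) := retract_mem _ _
  refine ⟨c, hcm, ?_, ?_⟩
  · rw [hx, mul_assoc g c, (commute_of_mem_para_star hcm).eq]
    group
  · have : y = g * (g⁻¹ * y * g) * g⁻¹ := by group
    rw [this, h4]
    group

end Length

/-! ### Half-spaces and walls in `A_Γ`. -/

section Halfspace

open scoped Pointwise

variable {V : Type u} {Γ : SimpleGraph V}

/-- The half-space bounded by the wall between `g` and `g * s` that contains `g * s`. -/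
def hs (g : RAAG Γ) (s : V × Bool) : Set (RAAG Γ) := {z | Starts s (g⁻¹ * z)}

theorem mem_hs {g z : RAAG Γ} {s : V × Bool} : z ∈ hs g s ↔ Starts s (g⁻¹ * z) := Iff.rfl

theorem smul_hs (x g : RAAG Γ) (s : V × Bool) : x • hs g s = hs (x * g) s := by
  ext z
  rw [Set.mem_smul_set_iff_inv_smul_mem, mem_hs, mem_hs, smul_eq_mul, mul_inv_rev, mul_assoc]

theorem compl_hs (g : RAAG Γ) (s : V × Bool) : (hs g s)ᶜ = hs (g * ltr Γ s) (linv s) := by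
  ext z
  rw [Set.mem_compl_iff, mem_hs, mem_hs, mul_inv_rev, mul_assoc, starts_inv_ltr_mul]

theorem hs_mul_para {s : V × Bool} {y : RAAG Γ} (hy : y ∈ para Γ (Γ.neighborSet s.1))
    (g : RAAG Γ) : hs (g * y) s = hs g s := by
  ext z
  rw [mem_hs, mem_hs, mul_inv_rev, mul_assoc, starts_para_mul (inv_mem hy)]

theorem notMem_hs_self (g : RAAG Γ) (s : V × Bool) : g ∉ hs g s := by
  rw [mem_hs, inv_mul_cancel]; exact not_starts_one s

theorem mul_ltr_mem_hs (g : RAAG Γ) (s : V × Bool) : g * ltr Γ s ∈ hs g s := by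
  rw [mem_hs, inv_mul_cancel_left]; exact starts_ltr s

theorem mul_mem_hs_iff {s : V × Bool} {S : Set V} (h : s.1 ∉ S) {y : RAAG Γ} (hy : y ∈ para Γ S)
    {g z : RAAG Γ} : z * y ∈ hs g s ↔ z ∈ hs g s := by
  rw [mem_hs, mem_hs, ← mul_assoc, starts_mul_para h hy]

theorem cross_hs {s t : V × Bool} {g z : RAAG Γ} (h : z ∉ hs g s) (h' : z * ltr Γ t ∈ hs g s) :
    t = s ∧ g⁻¹ * z ∈ para Γ (Γ.neighborSet s.1) :=
  cross h (by rwa [mem_hs, ← mul_assoc] at h')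

/-- The stabilizer of a half-space. -/
theorem conj_mem_of_smul_hs {x g : RAAG Γ} {s : V × Bool} (h : x • hs g s = hs g s) :
    g⁻¹ * x * g ∈ para Γ (Γ.neighborSet s.1) := by
  rw [smul_hs] at h
  have h1 : x * g ∉ hs g s := h ▸ notMem_hs_self _ _
  have h2 : x * g * ltr Γ s ∈ hs g s := h ▸ mul_ltr_mem_hs _ _
  have := (cross_hs h1 h2).2
  rwa [← mul_assoc] at this

/-- The half-spaces of label `a`. -/
def halfspaces (Γ : SimpleGraph V) (a : V) : Set (Set (RAAG Γ)) :=
  {K | ∃ g s, s.1 = a ∧ K = hs g s}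

theorem smul_mem_halfspaces {a : V} {K : Set (RAAG Γ)} (hK : K ∈ halfspaces Γ a) (x : RAAG Γ) :
    x • K ∈ halfspaces Γ a := by
  obtain ⟨g, s, hs, rfl⟩ := hK
  exact ⟨x * g, s, hs, smul_hs _ _ _⟩

theorem mul_mem_halfspace_iff {a : V} {K : Set (RAAG Γ)} (hK : K ∈ halfspaces Γ a) {S : Set V}
    (ha : a ∉ S) {y : RAAG Γ} (hy : y ∈ para Γ S) {z : RAAG Γ} : z * y ∈ K ↔ z ∈ K := by
  obtain ⟨g, s, rfl, rfl⟩ := hK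
  exact mul_mem_hs_iff ha hy

/-- A path from `q` to `p` crosses one wall per letter, and a separating half-space must be entered
along the path. -/
theorem finite_separating (a : V) (p q : RAAG Γ) :
    {K ∈ halfspaces Γ a | p ∈ K ∧ q ∉ K}.Finite := by
  have key : ∀ l : List (V × Bool),
      {K ∈ halfspaces Γ a | q * wordProd Γ l ∈ K ∧ q ∉ K}.Finite := by
    intro l
    induction l using List.reverseRecOn with
    | nil =>
      convert Set.finite_empty
      ext K
      simp
    | append_singleton l t ih =>
      refine (ih.union (Set.finite_singleton (hs (q * wordProd Γ l) t))).subset ?_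
      rintro K ⟨hK, h1, h2⟩
      by_cases h3 : q * wordProd Γ l ∈ K
      · exact Or.inl ⟨hK, h3, h2⟩
      · right
        obtain ⟨g, s, rfl, rfl⟩ := hK
        rw [wordProd_append, ← mul_assoc] at h1
        obtain ⟨rfl, h4⟩ := cross_hs h3 (by simpa using h1)
        rw [Set.mem_singleton_iff, ← hs_mul_para h4 g, mul_inv_cancel_left]
  obtain ⟨l, hl⟩ := exists_wordProd (q⁻¹ * p)
  have := key l
  rwa [hl, mul_inv_cancel_left] at this

/-- Half-spaces are connected. -/
theorem hs_connected {g : RAAG Γ} {s : V × Bool} {Q : RAAG Γ → Prop}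
    (h : ∀ z t, z ∈ hs g s → z * ltr Γ t ∈ hs g s → (Q z ↔ Q (z * ltr Γ t))) {z : RAAG Γ}
    (hz : z ∈ hs g s) : Q z ↔ Q (g * ltr Γ s) := by
  -- Each point of the half-space is `g * ltr Γ s * m⁻¹` with `s` followed by `m⁻¹` reduced. The
  -- prefixes of this product still start with `s` relative to `g`, so they trace a path inside the
  -- half-space.
  have key : ∀ m : RAAG Γ, Red (ltr Γ s) m⁻¹ →
      (Q (g * ltr Γ s * m⁻¹) ↔ Q (g * ltr Γ s)) := by
    refine starts_induction (by simp) ?_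
    intro t m ht ih hred
    have h0 : Red m⁻¹ (ltr Γ t)⁻¹ := by simpa using (red_ltr_iff.2 ht).symm_inv
    rw [mul_inv_rev] at hred
    have h1 : Red (ltr Γ s) m⁻¹ := hred.of_mul_right h0
    have h2 : g * ltr Γ s * m⁻¹ ∈ hs g s := by
      rw [mem_hs, mul_assoc, inv_mul_cancel_left]
      exact h1.starts (starts_ltr s)
    have h3 : g * ltr Γ s * m⁻¹ * ltr Γ (linv t) ∈ hs g s := by
      rw [mem_hs, mul_assoc, mul_assoc, inv_mul_cancel_left, ltr_linv]
      exact hred.starts (starts_ltr s)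
    have h4 := h _ _ h2 h3
    rw [ltr_linv] at h4
    rw [mul_inv_rev, ← mul_assoc, ← h4, ih h1]
  have h1 := key ((ltr Γ s)⁻¹ * (g⁻¹ * z))⁻¹ (by
    rw [inv_inv, red_ltr_iff, starts_inv_ltr_mul, not_not]; exact hz)
  simpa [mul_assoc] using h1

/-- An edge inside the first half-space that crosses the second wall is a translate of the edge at
`g'` by the link subgroup of `s'`. Such translations do not cross walls labelled `s`, so the edge at
`g'` would be inside too. Hence no edge crosses, and connectedness applies. -/
theorem subset_or_disjoint {g g' : RAAG Γ} {s s' : V × Bool} (hadj : ¬ Γ.Adj s'.1 s.1)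
    (h : ¬ (g' ∈ hs g s ∧ g' * ltr Γ s' ∈ hs g s)) :
    hs g s ⊆ hs g' s' ∨ hs g s ⊆ (hs g' s')ᶜ := by
  have aux : ∀ z t, z ∈ hs g s → z * ltr Γ t ∈ hs g s → z ∉ hs g' s' →
      z * ltr Γ t ∉ hs g' s' := by
    intro z t h1 h2 h3 h4
    obtain ⟨rfl, h5⟩ := cross_hs h3 h4
    apply h
    constructor
    · have := (mul_mem_hs_iff (s := s) (z := g') (g := g) hadj h5).1
        (by rwa [mul_inv_cancel_left])
      exact this
    · have := (mul_mem_hs_iff (s := s) (z := g' * ltr Γ t) (g := g) hadj h5).1 (by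
        rw [mul_assoc, (commute_ltr_of_mem_para h5).eq, ← mul_assoc, mul_inv_cancel_left]
        exact h2)
      exact this
  have h1 : ∀ z t, z ∈ hs g s → z * ltr Γ t ∈ hs g s →
      (z ∈ hs g' s' ↔ z * ltr Γ t ∈ hs g' s') := by
    intro z t hz hzt
    constructor
    · intro h2
      by_contra h3
      refine aux _ (linv t) hzt ?_ h3 ?_ <;> simpa
    · intro h2
      by_contra h3
      exact aux _ t hz hzt h3 h2
  by_cases h2 : g * ltr Γ s ∈ hs g' s'
  · exact Or.inl fun z hz => (hs_connected (Q := (· ∈ hs g' s')) h1 hz).2 h2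
  · exact Or.inr fun z hz hz' => h2 ((hs_connected (Q := (· ∈ hs g' s')) h1 hz).1 hz')

/-- Half-spaces with non-adjacent labels are nested. -/
theorem nested {a a' : V} (hadj : ¬ Γ.Adj a' a) {K K' : Set (RAAG Γ)}
    (hK : K ∈ halfspaces Γ a) (hK' : K' ∈ halfspaces Γ a') :
    K ⊆ K' ∨ K ⊆ K'ᶜ ∨ Kᶜ ⊆ K' ∨ Kᶜ ⊆ K'ᶜ := by
  obtain ⟨g, s, rfl, rfl⟩ := hK
  obtain ⟨g', s', rfl, rfl⟩ := hK'
  by_cases h : g' ∈ hs g s ∧ g' * ltr Γ s' ∈ hs g s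
  · rw [compl_hs g s]
    rcases subset_or_disjoint (g := g * ltr Γ s) (s := linv s) (g' := g') (s' := s') hadj
      (fun hc => by rw [← compl_hs] at hc; exact hc.1 h.1) with h | h
    · exact Or.inr (Or.inr (Or.inl h))
    · exact Or.inr (Or.inr (Or.inr h))
  · rcases subset_or_disjoint hadj h with h | h
    · exact Or.inl h
    · exact Or.inr (Or.inl h)

end Halfspace

/-! ### Cyclically reduced elements and the half-spaces they skewer. -/

section Skewer

open scoped Pointwise

variable {V : Type u} {Γ : SimpleGraph V}

/-- A cyclically reduced element. -/
def CycRed (x : RAAG Γ) : Prop := ∀ s, Starts s x → ¬ Starts s x⁻¹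

theorem exists_cycRed (x : RAAG Γ) : ∃ k y : RAAG Γ, CycRed y ∧ x = k * y * k⁻¹ := by
  induction hn : len x using Nat.strong_induction_on generalizing x with
  | _ n ih =>
    by_cases h : CycRed x
    · exact ⟨1, x, h, by simp⟩
    · simp only [CycRed, not_forall, not_not] at h
      obtain ⟨s, h1, h2⟩ := h
      have h3 : Red (x⁻¹ * ltr Γ s) (ltr Γ s)⁻¹ := by
        have : Red (ltr Γ s) ((ltr Γ s)⁻¹ * x) := by
          rw [red_ltr_iff, starts_inv_ltr_mul, not_not]; exact h1
        simpa using this.symm_inv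
      -- Otherwise the first letter `s` of the reduced product of `x⁻¹ * ltr Γ s` and `(ltr Γ s)⁻¹`
      -- would come from the second factor. Thus `x` begins with `s` and ends with its inverse, and
      -- conjugation shortens it by two.
      have h4 : Starts s (x⁻¹ * ltr Γ s) := by
        by_contra hc
        have := (h3.starts_right (s := s) (by simpa using h2) hc).2
        rw [← ltr_linv] at this
        exact linv_ne s (eq_of_starts_ltr this)
      have h5 := h4.len_inv_ltr_mul
      have h6 := h1.len_inv_ltr_mul
      have h7 : len (x⁻¹ * ltr Γ s) = len ((ltr Γ s)⁻¹ * x) := by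
        rw [← len_inv]; simp
      have h8 : len ((ltr Γ s)⁻¹ * x * ltr Γ s) = len ((ltr Γ s)⁻¹ * (x⁻¹ * ltr Γ s)) := by
        rw [← len_inv]; simp [mul_assoc]
      obtain ⟨k, y, hy, he⟩ := ih _ (by omega) ((ltr Γ s)⁻¹ * x * ltr Γ s) rfl
      refine ⟨ltr Γ s * k, y, hy, ?_⟩
      have : x = ltr Γ s * ((ltr Γ s)⁻¹ * x * ltr Γ s) * (ltr Γ s)⁻¹ := by group
      rw [this, he]
      group

/-- An element outside the subgroup generated by the vertices other than `a` has a reduced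
expression in which the letter `a` occurs. -/
theorem exists_prefix {a : V} {x : RAAG Γ} (hx : x ∉ para Γ {a}ᶜ) :
    ∃ g s, s.1 = a ∧ Red g (g⁻¹ * x) ∧ Starts s (g⁻¹ * x) := by
  revert hx
  refine starts_induction (motive := fun x => x ∉ para Γ {a}ᶜ →
    ∃ g s, s.1 = a ∧ Red g (g⁻¹ * x) ∧ Starts s (g⁻¹ * x)) (fun h => absurd (one_mem _) h) ?_ x
  intro t x ht ih hx
  by_cases hta : t.1 = a
  · exact ⟨1, t, hta, by simp [Red], by simpa using starts_ltr_mul.2 ht⟩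
  · obtain ⟨g, s, h1, h2, h3⟩ := ih fun h => hx (mul_mem (ltr_mem_para hta) h)
    refine ⟨ltr Γ t * g, s, h1, ?_, by simpa [mul_assoc] using h3⟩
    have h4 : Red (ltr Γ t) (g * (g⁻¹ * x)) := by
      rw [mul_inv_cancel_left]; exact red_ltr_iff.2 ht
    have h5 := h4.of_mul_right h2
    simp only [Red, mul_inv_rev, mul_assoc, inv_mul_cancel_left, mul_inv_cancel_left] at h2 h4 h5 ⊢
    omega

theorem Red.not_starts_inv {g h : RAAG Γ} (hr : Red g h) {s : V × Bool} (hs : Starts s h) :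
    ¬ Starts s g⁻¹ := by
  intro hc
  have h1 := hc.len_inv_ltr_mul
  have h2 := hs.len_inv_ltr_mul
  have h3 := len_mul_le (g * ltr Γ s) ((ltr Γ s)⁻¹ * h)
  have h4 : len (g * ltr Γ s) = len ((ltr Γ s)⁻¹ * g⁻¹) := by rw [← len_inv]; simp
  rw [mul_assoc, mul_inv_cancel_left] at h3
  rw [len_inv] at h1
  unfold Red at hr
  omega

/-- A cyclically reduced element involving the letter `a` skewers a half-space of label `a`. -/
theorem CycRed.exists_skewered {x : RAAG Γ} (hx : CycRed x) {a : V} (ha : x ∉ para Γ {a}ᶜ) :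
    ∃ K ∈ halfspaces Γ a, x • K ⊂ K := by
  obtain ⟨g, s, h1, h2, h3⟩ := exists_prefix ha
  have hxx : Red x x := red_of_no_cancellation fun t ht h => hx t h ht
  have hK : hs g s ∈ halfspaces Γ a := ⟨g, s, h1, rfl⟩
  have hg : ¬ Starts s g⁻¹ := h2.not_starts_inv h3
  have one_notMem : (1 : RAAG Γ) ∉ hs g s := by rw [mem_hs, mul_one]; exact hg
  have x_mem : x ∈ hs g s := h3
  have x_notMem : x ∉ x • hs g s := by
    rw [Set.mem_smul_set_iff_inv_smul_mem, smul_eq_mul, inv_mul_cancel]; exact one_notMem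
  have xinv : x⁻¹ ∉ hs g s := by
    intro h
    rw [mem_hs] at h
    have h4 : Red x g := by
      have : Red x (g * (g⁻¹ * x)) := by rwa [mul_inv_cancel_left]
      exact this.of_mul_right h2
    obtain ⟨h5, h6⟩ := h4.symm_inv.starts_right h hg
    refine hx s ?_ h6
    have := (starts_para_mul (s := s) (inv_mem h5) (g := g⁻¹ * x)).2 h3
    simpa using this
  have x2 : x * x ∈ hs g s := by
    rw [mem_hs, ← mul_assoc]
    have : Red (g⁻¹ * x) x := by
      have h4 : Red (g * (g⁻¹ * x)) x := by rwa [mul_inv_cancel_left]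
      exact h4.of_mul_left h2
    exact this.starts h3
  have x2' : x * x ∈ x • hs g s := ⟨x, x_mem, rfl⟩
  refine ⟨hs g s, hK, ?_, fun h => x_notMem (h x_mem)⟩
  -- The positions of `1`, `x` and `x * x` rule out all nestings except the inclusion of the
  -- translate.
  rcases nested (Γ.loopless.irrefl a) (smul_mem_halfspaces hK x) hK with h | h | h | h
  · exact h
  · exact absurd x2 (h x2')
  · refine absurd (h ?_) one_notMem
    rw [Set.mem_compl_iff, Set.mem_smul_set_iff_inv_smul_mem, smul_eq_mul, mul_one]
    exact xinv
  · exact absurd x_mem (h x_notMem)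

theorem zpow_smul_strictAnti {x : RAAG Γ} {K : Set (RAAG Γ)} (h : x • K ⊂ K) :
    StrictAnti fun n : ℤ => x ^ n • K := by
  refine strictAnti_int_of_succ_lt fun n => ?_
  rw [zpow_add_one, mul_smul]
  constructor
  · exact Set.smul_set_mono h.1
  · intro hc
    exact h.2 (Set.smul_set_subset_smul_set_iff.1 hc)

theorem exists_zpow_mul_mem {a : V} {x : RAAG Γ} {K : Set (RAAG Γ)} (hK : K ∈ halfspaces Γ a)
    (h : x • K ⊂ K) (p : RAAG Γ) : ∃ n : ℕ, p ∈ x ^ (-(n : ℤ)) • K := by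
  by_contra! hc
  obtain ⟨q, hq, -⟩ := Set.exists_of_ssubset h
  have hmono := zpow_smul_strictAnti h
  refine Set.infinite_of_injective_forall_mem (f := fun n : ℕ => x ^ (-(n : ℤ)) • K) ?_ ?_
    (finite_separating a q p)
  · intro m n hmn
    have := hmono.injective hmn
    omega
  · intro n
    refine ⟨smul_mem_halfspaces hK _, ?_, hc n⟩
    have : x ^ (0 : ℤ) • K ⊆ x ^ (-(n : ℤ)) • K := hmono.antitone (by omega)
    exact this (by simpa using hq)

theorem exists_zpow_mul_notMem {a : V} {x : RAAG Γ} {K : Set (RAAG Γ)} (hK : K ∈ halfspaces Γ a)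
    (h : x • K ⊂ K) (p : RAAG Γ) : ∃ n : ℕ, p ∉ x ^ (n : ℤ) • K := by
  by_contra! hc
  obtain ⟨q, -, hq⟩ := Set.exists_of_ssubset h
  have hmono := zpow_smul_strictAnti h
  refine Set.infinite_of_injective_forall_mem (f := fun n : ℕ => x ^ ((n : ℤ) + 1) • K) ?_ ?_
    (finite_separating a p q)
  · intro m n hmn
    have := hmono.injective hmn
    omega
  · intro n
    refine ⟨smul_mem_halfspaces hK _, by exact_mod_cast hc (n + 1), fun hn => hq ?_⟩
    have : x ^ ((n : ℤ) + 1) • K ⊆ x ^ (1 : ℤ) • K := hmono.antitone (by omega)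
    simpa using this hn

/-- Large negative powers of `x` expand both half-spaces until they contain `1`, so they are not
disjoint; large positive powers shrink both until they miss `1`, so they do not cover the group. -/
theorem comparable_of_skewered {a : V} {x : RAAG Γ} {K L : Set (RAAG Γ)}
    (hK : K ∈ halfspaces Γ a) (hL : L ∈ halfspaces Γ a) (hxK : x • K ⊂ K) (hxL : x • L ⊂ L) :
    K ⊆ L ∨ L ⊆ K := by
  rcases nested (Γ.loopless.irrefl a) hK hL with h | h | h | h
  · exact Or.inl h
  · exfalso
    obtain ⟨n, hn⟩ := exists_zpow_mul_mem hK hxK 1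
    obtain ⟨m, hm⟩ := exists_zpow_mul_mem hL hxL 1
    have h1 := (zpow_smul_strictAnti hxK).antitone (a := -((max n m : ℕ) : ℤ))
      (b := -(n : ℤ)) (by simp) hn
    have h2 := (zpow_smul_strictAnti hxL).antitone (a := -((max n m : ℕ) : ℤ))
      (b := -(m : ℤ)) (by simp) hm
    rw [Set.mem_smul_set_iff_inv_smul_mem] at h1 h2
    exact h h1 h2
  · exfalso
    obtain ⟨n, hn⟩ := exists_zpow_mul_notMem hK hxK 1
    obtain ⟨m, hm⟩ := exists_zpow_mul_notMem hL hxL 1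
    have h1 : (1 : RAAG Γ) ∉ x ^ ((max n m : ℕ) : ℤ) • K := fun hc => hn
      ((zpow_smul_strictAnti hxK).antitone (a := (n : ℤ)) (by simp) hc)
    have h2 : (1 : RAAG Γ) ∉ x ^ ((max n m : ℕ) : ℤ) • L := fun hc => hm
      ((zpow_smul_strictAnti hxL).antitone (a := (m : ℤ)) (by simp) hc)
    rw [Set.mem_smul_set_iff_inv_smul_mem] at h1 h2
    exact h2 (h h1)
  · exact Or.inr (Set.compl_subset_compl.1 h)

/-- If `x` skewers a half-space of label `a` and `y` commutes with `x`, then the product of a power of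
`x` and a nontrivial power of `y` is conjugate into the subgroup generated by the link of `a`. -/
theorem exists_zpow_mul_pow_conj_mem {a : V} {x y : RAAG Γ} {K : Set (RAAG Γ)}
    (hK : K ∈ halfspaces Γ a) (hxK : x • K ⊂ K) (hxy : Commute x y) :
    ∃ (m n : ℤ) (g : RAAG Γ), n ≠ 0 ∧ g⁻¹ * (x ^ m * y ^ n) * g ∈ para Γ (Γ.neighborSet a) := by
  obtain ⟨p, hp, hp'⟩ := Set.exists_of_ssubset hxK
  have hz : ∀ z, Commute x z → x • z • K ⊂ z • K := by
    intro z hz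
    rw [← mul_smul, hz.eq, mul_smul]
    exact ⟨Set.smul_set_mono hxK.1, fun hc => hxK.2 (Set.smul_set_subset_smul_set_iff.1 hc)⟩
  have hcomp : ∀ (i : ℕ) (j : ℤ), y ^ i • K ⊆ x ^ j • K ∨ x ^ j • K ⊆ y ^ i • K := fun i j =>
    comparable_of_skewered (smul_mem_halfspaces hK _) (smul_mem_halfspaces hK _)
      (hz _ (hxy.pow_right i)) (hz _ ((Commute.refl x).zpow_right j))
  -- Each `y ^ i • K` is comparable with every `x ^ j • K`. Taking `j i` greatest with `y ^ i • K ⊆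
  -- x ^ j • K` traps `(x ^ (-j i) * y ^ i) • K` between `x • K` and `K`. Only finitely many
  -- half-spaces of label `a` fit there, so two of these coincide and give an element stabilizing
  -- `K`.
  have hmono := zpow_smul_strictAnti hxK
  have hex : ∀ i : ℕ, ∃ j : ℤ, y ^ i • K ⊆ x ^ j • K ∧ ¬ y ^ i • K ⊆ x ^ (j + 1) • K := by
    intro i
    obtain ⟨q, hq⟩ : (y ^ i • K).Nonempty := Set.Nonempty.smul_set ⟨p, hp⟩
    obtain ⟨r, hr⟩ : ∃ r, r ∉ y ^ i • K := by
      refine ⟨y ^ i * (x⁻¹ * p), fun hc => hp' ?_⟩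
      rw [Set.mem_smul_set_iff_inv_smul_mem] at hc ⊢
      simpa using hc
    obtain ⟨m, hm⟩ := exists_zpow_mul_mem hK hxK r
    obtain ⟨n, hn⟩ := exists_zpow_mul_notMem hK hxK q
    obtain ⟨j, hj, hj'⟩ := Int.exists_greatest_of_bdd (P := fun j => y ^ i • K ⊆ x ^ j • K)
      ⟨n, fun z hzz => by
        by_contra hc
        exact hn (hmono.antitone (by omega) (hzz hq))⟩
      ⟨-m, (hcomp i _).resolve_right fun hc => hr (hc hm)⟩
    exact ⟨j, hj, fun hc => by have := hj' _ hc; omega⟩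
  choose j hj hj' using hex
  have hsep : ∀ i : ℕ, (x ^ (-j i) * y ^ i) • K ∈
      {K ∈ halfspaces Γ a | x * p ∈ K ∧ x⁻¹ * p ∉ K} := by
    intro i
    have h1 : (x ^ (-j i) * y ^ i) • K ⊆ K := by
      have := Set.smul_set_mono (a := x ^ (-j i)) (hj i)
      rwa [← mul_smul, ← mul_smul, ← zpow_add, neg_add_cancel, zpow_zero, one_smul] at this
    have h2 : x • K ⊆ (x ^ (-j i) * y ^ i) • K := by
      have := Set.smul_set_mono (a := x ^ (-j i)) ((hcomp i (j i + 1)).resolve_left (hj' i))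
      rwa [← mul_smul, ← mul_smul, ← zpow_add, neg_add_cancel_left, zpow_one] at this
    refine ⟨smul_mem_halfspaces hK _, h2 ⟨p, hp, rfl⟩, fun hc => hp' ?_⟩
    rw [Set.mem_smul_set_iff_inv_smul_mem]
    exact h1 hc
  obtain ⟨m, n, hmn, he⟩ : ∃ m n : ℕ, m ≠ n ∧
      (x ^ (-j m) * y ^ m) • K = (x ^ (-j n) * y ^ n) • K := by
    by_contra! hc
    exact Set.infinite_of_injective_forall_mem (f := fun n : ℕ => (x ^ (-j n) * y ^ n) • K)
      (fun m n h => by by_contra hne; exact hc m n hne h) hsep (finite_separating a _ _)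
  obtain ⟨g, s, rfl, rfl⟩ := hK
  refine ⟨j n - j m, m - n, g, by omega, conj_mem_of_smul_hs ?_⟩
  have h1 : x ^ (j n - j m) * y ^ ((m : ℤ) - n) =
      (x ^ (-j n) * y ^ n)⁻¹ * (x ^ (-j m) * y ^ m) := by
    have hc : ∀ i k : ℤ, Commute (x ^ i) (y ^ k) := fun i k => hxy.zpow_zpow i k
    rw [mul_inv_rev, ← zpow_neg, neg_neg, ← zpow_natCast, ← zpow_natCast, ← zpow_neg,
      mul_assoc, ← mul_assoc (x ^ _), ← zpow_add, ← mul_assoc, ← (hc _ _).eq, mul_assoc,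
      ← zpow_add]
    congr 2; ring
  rw [h1, mul_smul, he, inv_smul_smul]

/-- Some half-space of label `a` separates `1` from `k`. Neither `x` nor `k⁻¹ * x * k` involves `a`,
so all its translates by powers of `x` separate them too; by finiteness a nontrivial power of `x`
stabilizes it. -/
theorem exists_zpow_conj_mem {a : V} {x k : RAAG Γ} (hx : x ∈ para Γ {a}ᶜ)
    (hk : k⁻¹ * x * k ∈ para Γ {a}ᶜ) (hka : k ∉ para Γ {a}ᶜ) :
    ∃ (n : ℤ) (g : RAAG Γ), n ≠ 0 ∧ g⁻¹ * x ^ n * g ∈ para Γ (Γ.neighborSet a) := by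
  obtain ⟨b, s, h1, h2, h3⟩ := exists_prefix hka
  have hK : hs b s ∈ halfspaces Γ a := ⟨b, s, h1, rfl⟩
  have one_notMem : (1 : RAAG Γ) ∉ hs b s := by
    rw [mem_hs, mul_one]; exact h2.not_starts_inv h3
  have hsep : ∀ n : ℕ, x ^ n • hs b s ∈ {K ∈ halfspaces Γ a | k ∈ K ∧ 1 ∉ K} := by
    intro n
    refine ⟨smul_mem_halfspaces hK _, ?_, ?_⟩
    · have h4 : (x ^ n)⁻¹ * k = k * ((k⁻¹ * x * k) ^ n)⁻¹ := by
        have := conj_pow (i := n) (a := k⁻¹) (b := x)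
        rw [inv_inv] at this
        rw [this]; group
      rw [Set.mem_smul_set_iff_inv_smul_mem, smul_eq_mul, h4,
        mul_mem_halfspace_iff hK (by simp) (inv_mem (pow_mem hk n))]
      exact h3
    · rw [Set.mem_smul_set_iff_inv_smul_mem, smul_eq_mul, mul_one, ← one_mul (x ^ n)⁻¹,
        mul_mem_halfspace_iff hK (by simp) (inv_mem (pow_mem hx n))]
      exact one_notMem
  obtain ⟨m, n, hmn, he⟩ : ∃ m n : ℕ, m ≠ n ∧ x ^ m • hs b s = x ^ n • hs b s := by
    by_contra! hc
    exact Set.infinite_of_injective_forall_mem (f := fun n : ℕ => x ^ n • hs b s)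
      (fun m n h => by by_contra hne; exact hc m n hne h) hsep (finite_separating a k 1)
  refine ⟨(m : ℤ) - n, b, by omega, h1 ▸ conj_mem_of_smul_hs ?_⟩
  rw [sub_eq_neg_add, zpow_add, mul_smul, zpow_natCast, he, ← zpow_natCast, ← mul_smul,
    ← zpow_add, neg_add_cancel, zpow_zero, one_smul]

end Skewer

/-! ### Peak reduction for conjugating automorphisms. -/

section Conjugating

open scoped Pointwise

variable {V : Type u} {Γ : SimpleGraph V}

theorem conj_mem_para_neighborSet {a : V} {c y : RAAG Γ} (hc : c ∈ para Γ (star Γ a))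
    (hy : y ∈ para Γ (Γ.neighborSet a)) : c * y * c⁻¹ ∈ para Γ (Γ.neighborSet a) := by
  refine para_induction (motive := fun c => c * y * c⁻¹ ∈ para Γ (Γ.neighborSet a)) (by simpa) ?_ hc
  intro s hs g hg
  have h1 : ltr Γ s * g * y * (ltr Γ s * g)⁻¹ = ltr Γ s * (g * y * g⁻¹) * (ltr Γ s)⁻¹ := by group
  rw [h1]
  rcases hs with e | e
  · rw [(commute_ltr_of_mem_para (s := s) (by rwa [e])).eq, mul_inv_cancel_right]
    exact hg
  · exact mul_mem (mul_mem (ltr_mem_para e) hg) (inv_mem (ltr_mem_para e))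

theorem inv_mul_mem_para_star {a : V} {g h : RAAG Γ}
    (e : g * gen Γ a * g⁻¹ = h * gen Γ a * h⁻¹) : g⁻¹ * h ∈ para Γ (star Γ a) := by
  refine mem_para_star_of_commute ?_
  have h1 : gen Γ a = g⁻¹ * (h * gen Γ a * h⁻¹) * g := by rw [← e]; group
  unfold Commute SemiconjBy
  nth_rw 2 [h1]
  group

/-- The least length of an element conjugating the generator `a` to its image under `f`. -/
noncomputable def cost (f : MulAut (RAAG Γ)) (a : V) : ℕ :=
  sInf {n | ∃ g : RAAG Γ, len g = n ∧ f (gen Γ a) = g * gen Γ a * g⁻¹}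

theorem cost_le {f : MulAut (RAAG Γ)} {a : V} {g : RAAG Γ}
    (h : f (gen Γ a) = g * gen Γ a * g⁻¹) : cost f a ≤ len g :=
  Nat.sInf_le ⟨g, rfl, h⟩

theorem exists_len_eq_cost {f : MulAut (RAAG Γ)} (hf : f ∈ PAut Γ) (a : V) :
    ∃ g : RAAG Γ, len g = cost f a ∧ f (gen Γ a) = g * gen Γ a * g⁻¹ := by
  obtain ⟨g, hg⟩ := isConj_iff.1 (hf a)
  exact Nat.sInf_mem (s := {n | ∃ g : RAAG Γ, len g = n ∧ f (gen Γ a) = g * gen Γ a * g⁻¹})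
    ⟨_, g, rfl, hg.symm⟩

/-- A final letter of `g` in the star commutes with `a` and could be dropped from the conjugator. -/
theorem not_starts_inv_of_len_eq_cost {f : MulAut (RAAG Γ)} {a : V} {g : RAAG Γ}
    (hl : len g = cost f a) (hg : f (gen Γ a) = g * gen Γ a * g⁻¹) {s : V × Bool}
    (hs : s.1 ∈ star Γ a) : ¬ Starts s g⁻¹ := by
  intro h
  have h1 := h.len_inv_ltr_mul
  have h2 : len ((ltr Γ s)⁻¹ * g⁻¹) = len (g * ltr Γ s) := by rw [← len_inv]; simp
  have h3 := commute_of_mem_para_star (ltr_mem_para (Γ := Γ) hs)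
  have h4 := cost_le (f := f) (a := a) (g := g * ltr Γ s) (by
    rw [hg, mul_assoc g (ltr Γ s), h3.eq]; group)
  rw [len_inv] at h1
  omega

theorem map_ltr_eq {f : MulAut (RAAG Γ)} {g : V → RAAG Γ}
    (hg : ∀ a, f (gen Γ a) = g a * gen Γ a * (g a)⁻¹) (s : V × Bool) :
    f (ltr Γ s) = g s.1 * ltr Γ s * (g s.1)⁻¹ := by
  rcases s with ⟨a, _ | _⟩
  · simp only [ltr, Bool.false_eq_true, if_false, map_inv, hg]; group
  · simp only [ltr, if_true, hg]

/-- The images of the adjacent generators have a common conjugator in `g s.1 * ⟨st(s.1)⟩`, and the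
link subgroup is normal in the star subgroup. So `f (ltr Γ t)` stabilizes the half-space. -/
theorem map_ltr_mul_mem_hs_iff {f : MulAut (RAAG Γ)} {g : V → RAAG Γ}
    (hg : ∀ a, f (gen Γ a) = g a * gen Γ a * (g a)⁻¹) {s t : V × Bool} (h : Γ.Adj s.1 t.1)
    (z : RAAG Γ) : f (ltr Γ t) * z ∈ hs (g s.1) s ↔ z ∈ hs (g s.1) s := by
  have hc : Commute (f (gen Γ s.1)) (f (gen Γ t.1)) := (gen_commute h).map f
  obtain ⟨c, hc, h1, h2⟩ := exists_common_conj h (hg s.1)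
    (isConj_iff.2 ⟨g t.1, (hg t.1).symm⟩) hc
  have h3 : f (ltr Γ t) = g s.1 * (c * ltr Γ t * c⁻¹) * (g s.1)⁻¹ := by
    rcases t with ⟨a, _ | _⟩
    · simp only [ltr, Bool.false_eq_true, if_false, map_inv, h2]; group
    · simp only [ltr, if_true, h2]; group
  rw [h3, mem_hs, mem_hs, ← starts_para_mul (s := s)
    (conj_mem_para_neighborSet hc (ltr_mem_para (Γ := Γ) (s := t) h)) (g := (g s.1)⁻¹ * z)]
  simp only [mul_assoc, inv_mul_cancel_left]

/-- Ping-pong: a conjugating automorphism whose half-spaces are pairwise disjoint detects the first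
letters of reduced words. -/
theorem starts_iff_map_mem_hs {f : MulAut (RAAG Γ)} {g : V → RAAG Γ}
    (hg : ∀ a, f (gen Γ a) = g a * gen Γ a * (g a)⁻¹) (hone : ∀ s, 1 ∉ hs (g s.1) s)
    (hdis : ∀ s t : V × Bool, t.1 ∉ star Γ s.1 → Disjoint (hs (g s.1) s) (hs (g t.1) t))
    (x : RAAG Γ) : ∀ s, Starts s x ↔ f x ∈ hs (g s.1) s := by
  refine starts_induction (motive := fun x => ∀ s, Starts s x ↔ f x ∈ hs (g s.1) s) ?_ ?_ x
  · intro s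
    rw [map_one]
    exact iff_of_false (not_starts_one s) (hone s)
  · intro t x ht ih s
    have h1 : Starts t (ltr Γ t * x) := starts_ltr_mul.2 ht
    have h2 : f (ltr Γ t * x) ∈ hs (g t.1) t := by
      rw [map_mul, map_ltr_eq hg, mem_hs]
      have : (g t.1)⁻¹ * (g t.1 * ltr Γ t * (g t.1)⁻¹ * f x) = ltr Γ t * ((g t.1)⁻¹ * f x) := by
        group
      rw [this, starts_ltr_mul]
      exact fun hc => ht ((ih (linv t)).2 hc)
    by_cases hadj : Γ.Adj s.1 t.1
    · rw [starts_ltr_mul_of_adj hadj.symm, map_mul, map_ltr_mul_mem_hs_iff hg hadj, ih]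
    by_cases hst : s = t
    · subst hst
      exact iff_of_true h1 h2
    refine iff_of_false (fun hc => ?_) (fun hc => ?_)
    · rcases hc.eq_or_adj h1 with e | e
      · exact hst e.symm
      · exact hadj e
    · by_cases he : s.1 = t.1
      · have : s = linv t := Prod.ext he (by
          by_contra hne
          exact hst (Prod.ext he (by simpa [linv] using hne)))
        subst this
        exact Starts.not_linv h2 hc
      · refine Set.disjoint_left.1 (hdis s t ?_) hc h2
        rintro (e | e)
        · exact he e.symm
        · exact hadj e

/-- Surjectivity enters here: a first letter `s` of the preimage of `a` puts `a` in the half-space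
of `s`, while `1` lies outside. The edge from `1` to `a` thus crosses this wall, which forces `s` to
be `a` and `g a` to commute with `a`. -/
theorem eq_one_of_disjoint {f : MulAut (RAAG Γ)} {g : V → RAAG Γ}
    (hg : ∀ a, f (gen Γ a) = g a * gen Γ a * (g a)⁻¹) (hone : ∀ s, 1 ∉ hs (g s.1) s)
    (hdis : ∀ s t : V × Bool, t.1 ∉ star Γ s.1 → Disjoint (hs (g s.1) s) (hs (g t.1) t)) :
    f = 1 := by
  have key : ∀ a, f (gen Γ a) = gen Γ a := by
    intro a
    have hne : f.symm (gen Γ a) ≠ 1 := by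
      intro h
      rw [MulEquiv.symm_apply_eq, map_one] at h
      have := starts_ltr (Γ := Γ) (a, true)
      rw [ltr_true, h] at this
      exact not_starts_one _ this
    obtain ⟨s, hs⟩ := exists_starts hne
    rw [starts_iff_map_mem_hs hg hone hdis, MulEquiv.apply_symm_apply] at hs
    obtain ⟨rfl, h⟩ := cross_hs (t := (a, true)) (hone s) (by rwa [one_mul])
    rw [mul_one] at h
    have := commute_of_mem_para_star (para_mono (Set.subset_insert _ _) (inv_mem h))
    rw [hg, inv_inv] at *
    rw [this.eq, mul_inv_cancel_right]
  have h : f.toMonoidHom = MonoidHom.id _ := PresentedGroup.ext key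
  exact MulEquiv.ext fun x => DFunLike.congr_fun h x

theorem isUnionOfComponents_of_closed {a : V} {C : Set V} (h1 : ∀ w ∈ C, w ∉ star Γ a)
    (h2 : ∀ w ∈ C, ∀ u, u ∉ star Γ a → Γ.Adj w u → u ∈ C) : IsUnionOfComponents Γ a C := by
  refine ⟨{K | ∀ x ∈ K.supp, x.1 ∈ C}, ?_⟩
  ext w
  constructor
  · intro hw
    refine ⟨⟨w, h1 w hw⟩, ?_, rfl⟩
    simp only [Set.mem_ofPred_eq, Set.mem_iUnion]
    refine ⟨(Γ.induce (star Γ a)ᶜ).connectedComponentMk ⟨w, h1 w hw⟩, ?_, rfl⟩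
    intro x hx
    have hr : (Γ.induce (star Γ a)ᶜ).Reachable ⟨w, h1 w hw⟩ x :=
      (SimpleGraph.ConnectedComponent.exact hx).symm
    obtain ⟨p⟩ := hr
    suffices ∀ (y z : ((star Γ a)ᶜ : Set V)) (p : (Γ.induce (star Γ a)ᶜ).Walk y z),
        y.1 ∈ C → z.1 ∈ C from this _ _ p hw
    intro y z p
    induction p with
    | nil => exact id
    | @cons _ v _ hadj _ ih => exact fun hy => ih (h2 _ hy _ v.2 hadj)
  · rintro ⟨x, hx, rfl⟩
    simp only [Set.mem_ofPred_eq, Set.mem_iUnion] at hx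
    obtain ⟨K, hK, hxK⟩ := hx
    exact hK x hxK

theorem partialConj_gen_of_mem {a : V} {C : Set V} (hC : IsUnionOfComponents Γ a C) {b : V}
    (hb : b ∈ C) : partialConj a C hC (gen Γ b) = gen Γ a * gen Γ b * (gen Γ a)⁻¹ :=
  conjHom_gen_of_mem C _ (fun _ _ hb hbc hc => hC.commute_gen hb hbc hc) hb

theorem partialConj_gen_of_notMem {a : V} {C : Set V} (hC : IsUnionOfComponents Γ a C) {b : V}
    (hb : b ∉ C) : partialConj a C hC (gen Γ b) = gen Γ b :=
  conjHom_gen_of_notMem C _ (fun _ _ hb hbc hc => hC.commute_gen hb hbc hc) hb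

theorem partialConj_inv_gen_of_mem {a : V} {C : Set V} (hC : IsUnionOfComponents Γ a C) {b : V}
    (hb : b ∈ C) : (partialConj a C hC)⁻¹ (gen Γ b) = (gen Γ a)⁻¹ * gen Γ b * gen Γ a := by
  have h : (partialConj a C hC)⁻¹ (gen Γ b) = (gen Γ a)⁻¹ * gen Γ b * (gen Γ a)⁻¹⁻¹ :=
    conjHom_gen_of_mem C _ (fun _ _ hb hbc hc => (hC.commute_gen hb hbc hc).inv_left) hb
  rwa [inv_inv] at h

theorem partialConj_inv_gen_of_notMem {a : V} {C : Set V} (hC : IsUnionOfComponents Γ a C) {b : V}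
    (hb : b ∉ C) : (partialConj a C hC)⁻¹ (gen Γ b) = gen Γ b :=
  conjHom_gen_of_notMem C _ (fun _ _ hb hbc hc => (hC.commute_gen hb hbc hc).inv_left) hb

theorem partialConj_mem_PAut {a : V} {C : Set V} (hC : IsUnionOfComponents Γ a C) :
    partialConj a C hC ∈ PAut Γ := by
  intro b
  by_cases hb : b ∈ C
  · rw [partialConj_gen_of_mem hC hb]
    exact isConj_iff.2 ⟨_, rfl⟩
  · rw [partialConj_gen_of_notMem hC hb]

/-- A nontrivial conjugating automorphism becomes simpler after composition with a suitable partial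
conjugation or its inverse. -/
theorem exists_reduction {f : MulAut (RAAG Γ)} (hf : f ∈ PAut Γ) (hne : f ≠ 1) :
    ∃ (a : V) (C : Set V) (hC : IsUnionOfComponents Γ a C) (K : Set (RAAG Γ)),
      K ∈ halfspaces Γ a ∧
      (∀ w g, f (gen Γ w) = g * gen Γ w * g⁻¹ → (w ∈ C ↔ w ∉ star Γ a ∧ g ∈ K)) ∧
      ∃ P : MulAut (RAAG Γ), (P = partialConj a C hC ∨ P = (partialConj a C hC)⁻¹) ∧
        (∀ w, cost (f * P) w ≤ cost f w) ∧ ∃ w, cost (f * P) w < cost f w := by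
  choose g hl hg using exists_len_eq_cost hf
  have hone : ∀ s : V × Bool, 1 ∉ hs (g s.1) s := by
    intro s h
    rw [mem_hs, mul_one] at h
    exact not_starts_inv_of_len_eq_cost (hl _) (hg _) (Set.mem_insert _ _) h
  -- Without such a pair, nestedness leaves only disjointness for half-spaces at non-adjacent
  -- vertices, and ping-pong makes `f` trivial.
  obtain ⟨s, w₀, hw₀, hw₀'⟩ : ∃ (s : V × Bool) (w : V), w ∉ star Γ s.1 ∧ g w ∈ hs (g s.1) s := by
    by_contra! hc
    refine hne (eq_one_of_disjoint hg hone fun s t hst => ?_)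
    have hst' : s.1 ∉ star Γ t.1 := by
      rintro (e | e)
      · exact hst (Or.inl e.symm)
      · exact hst (Or.inr (SimpleGraph.Adj.symm e))
    have aux : ∀ s t : V × Bool, t.1 ∉ star Γ s.1 → g t.1 * ltr Γ t ∉ hs (g s.1) s := by
      intro s t hst
      rw [mul_mem_hs_iff (S := {t.1}) (fun e => hst (Or.inl e.symm)) (ltr_mem_para rfl)]
      exact hc s t.1 hst
    rcases nested (fun e => hst (Or.inr e.symm)) ⟨g s.1, s, rfl, rfl⟩ ⟨g t.1, t, rfl, rfl⟩
      with h | h | h | h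
    · exact absurd (h (mul_ltr_mem_hs _ _)) (aux t s hst')
    · exact Set.disjoint_left.2 h
    · exact absurd (h (hone s)) (hone t)
    · exact absurd (mul_ltr_mem_hs (g t.1) t) (h (aux s t hst))
  set a := s.1 with ha
  set C : Set V := {w | w ∉ star Γ a ∧ g w ∈ hs (g a) s} with hCdef
  have hK : hs (g a) s ∈ halfspaces Γ a := ⟨_, _, rfl, rfl⟩
  -- Membership in `C` does not depend on the conjugator: two choices differ by an element of
  -- `⟨st(w)⟩`, which does not involve `a`.
  have hmem : ∀ w h, f (gen Γ w) = h * gen Γ w * h⁻¹ →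
      (w ∈ C ↔ w ∉ star Γ a ∧ h ∈ hs (g a) s) := by
    intro w h hw
    refine and_congr_right fun hwa => ?_
    have h1 : (g w)⁻¹ * h ∈ para Γ (star Γ w) := inv_mul_mem_para_star ((hg w).symm.trans hw)
    have h2 : a ∉ star Γ w := by
      rintro (e | e)
      · exact hwa (Or.inl e.symm)
      · exact hwa (Or.inr (SimpleGraph.Adj.symm e))
    have := mul_mem_halfspace_iff hK h2 h1 (z := g w)
    rw [mul_inv_cancel_left] at this
    exact this.symm
  have hC : IsUnionOfComponents Γ a C := by
    refine isUnionOfComponents_of_closed (fun w hw => hw.1) fun w hw u hu hwu => ?_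
    obtain ⟨c, -, h1, h2⟩ := exists_common_conj hwu (hg w)
      (isConj_iff.2 ⟨g u, (hg u).symm⟩) ((gen_commute hwu).map f)
    exact (hmem u _ h2).2 ⟨hu, ((hmem w _ h1).1 hw).2⟩
  refine ⟨a, C, hC, hs (g a) s, hK, hmem, ?_⟩
  obtain ⟨P, hP, hPC, hPC'⟩ : ∃ P : MulAut (RAAG Γ),
      (P = partialConj a C hC ∨ P = (partialConj a C hC)⁻¹) ∧
      (∀ w ∈ C, P (gen Γ w) = (ltr Γ s)⁻¹ * gen Γ w * ltr Γ s) ∧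
      (∀ w ∉ C, P (gen Γ w) = gen Γ w) := by
    rcases hs2 : s.2 with _ | _
    · refine ⟨_, Or.inl rfl, fun w hw => ?_, fun w hw => partialConj_gen_of_notMem hC hw⟩
      rw [partialConj_gen_of_mem hC hw]
      simp [ltr, hs2, ha]
    · refine ⟨_, Or.inr rfl, fun w hw => ?_, fun w hw => partialConj_inv_gen_of_notMem hC hw⟩
      rw [partialConj_inv_gen_of_mem hC hw]
      simp [ltr, hs2, ha]
  -- For `w ∈ C` the conjugator `g w` is `g a` followed by `s` and a remainder, without
  -- cancellation. Composition with `P` deletes this letter `s`.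
  have hlt : ∀ w ∈ C, cost (f * P) w < cost f w := by
    intro w hw
    have h1 : Starts s ((g a)⁻¹ * g w) := hw.2
    have h2 : Red (g a) ((g a)⁻¹ * g w) := by
      refine red_of_no_cancellation fun t ht ht' => ?_
      refine not_starts_inv_of_len_eq_cost (hl a) (hg a) ?_ ht
      rcases h1.eq_or_adj ht' with rfl | e
      · exact Set.mem_insert _ _
      · exact Or.inr e
    have h3 := h1.len_inv_ltr_mul
    have h4 := len_mul_le (g a) ((ltr Γ s)⁻¹ * ((g a)⁻¹ * g w))
    unfold Red at h2
    rw [mul_inv_cancel_left] at h2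
    have h5 := cost_le (f := f * P) (a := w) (g := g a * ((ltr Γ s)⁻¹ * ((g a)⁻¹ * g w))) (by
      rw [MulAut.mul_apply, hPC w hw, map_mul, map_mul, map_inv, map_ltr_eq hg, hg w, ← ha]
      group)
    have h6 := hl w
    omega
  refine ⟨P, hP, fun w => ?_, w₀, hlt w₀ ⟨hw₀, hw₀'⟩⟩
  by_cases hw : w ∈ C
  · exact (hlt w hw).le
  · rw [cost, cost, MulAut.mul_apply, hPC' w hw]

end Conjugating

/-! ### Exponent sums and the Heisenberg quotient. -/

section Exponent

variable {V : Type u} {Γ : SimpleGraph V}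

open Classical in
/-- The exponent sum of a generator, as a homomorphism. -/
noncomputable def expHom (Γ : SimpleGraph V) (a : V) : RAAG Γ →* Multiplicative ℤ :=
  lift (fun b => if b = a then Multiplicative.ofAdd 1 else 1) fun _ _ _ => Commute.all _ _

/-- The exponent sum of the generator `a` in `g`. -/
noncomputable def ex (a : V) (g : RAAG Γ) : ℤ := (expHom Γ a g).toAdd

open Classical in
theorem ex_gen (a b : V) : ex a (gen Γ b) = if b = a then 1 else 0 := by
  rw [ex, expHom, lift_gen]
  split_ifs <;> rfl

theorem ex_gen_self (a : V) : ex a (gen Γ a) = 1 := by rw [ex_gen, if_pos rfl]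

theorem ex_gen_of_ne {a b : V} (h : b ≠ a) : ex a (gen Γ b) = 0 := by rw [ex_gen, if_neg h]

@[simp] theorem ex_mul (a : V) (g h : RAAG Γ) : ex a (g * h) = ex a g + ex a h := by simp [ex]

@[simp] theorem ex_inv (a : V) (g : RAAG Γ) : ex a g⁻¹ = -ex a g := by simp [ex]

@[simp] theorem ex_zpow (a : V) (g : RAAG Γ) (n : ℤ) : ex a (g ^ n) = n * ex a g := by simp [ex]

theorem ex_conj (a : V) (g h : RAAG Γ) : ex a (g * h * g⁻¹) = ex a h := by simp

theorem ex_eq_zero_of_mem_para {a : V} {S : Set V} (ha : a ∉ S) {g : RAAG Γ}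
    (hg : g ∈ para Γ S) : ex a g = 0 := by
  have h : para Γ S ≤ (expHom Γ a).ker := by
    rw [para, Subgroup.closure_le]
    rintro _ ⟨b, hb, rfl⟩
    exact ex_gen_of_ne (Γ := Γ) (fun e => ha (e ▸ hb))
  exact h hg

theorem ex_map_of_mem_PAut {f : MulAut (RAAG Γ)} (hf : f ∈ PAut Γ) (a : V) (g : RAAG Γ) :
    ex a (f g) = ex a g := by
  have h : (expHom Γ a).comp f.toMonoidHom = expHom Γ a := PresentedGroup.ext fun b => by
    obtain ⟨k, hk⟩ := isConj_iff.1 (hf b)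
    change ex a (f (gen Γ b)) = ex a (gen Γ b)
    rw [← hk, ex_conj]
  exact DFunLike.congr_fun h g

theorem toAdd_eq_sum [Fintype V] (ψ : RAAG Γ →* Multiplicative ℤ) (g : RAAG Γ) :
    (ψ g).toAdd = ∑ b, ex b g * (ψ (gen Γ b)).toAdd := by
  classical
  have h : ψ = MonoidHom.mk' (fun g => Multiplicative.ofAdd
      (∑ b, ex b g * (ψ (gen Γ b)).toAdd)) (fun g h => by
        rw [← ofAdd_add, ← Finset.sum_add_distrib]
        simp only [ex_mul, add_mul]) := PresentedGroup.ext fun a => by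
    change ψ (gen Γ a) = Multiplicative.ofAdd (∑ b, ex b (gen Γ a) * (ψ (gen Γ b)).toAdd)
    simp [ex_gen]
  conv_lhs => rw [h]
  rfl

/-- The integral Heisenberg group. -/
@[ext] structure Heisenberg where
  x : ℤ
  y : ℤ
  z : ℤ

namespace Heisenberg

instance : Mul Heisenberg := ⟨fun g h => ⟨g.x + h.x, g.y + h.y, g.z + h.z + g.x * h.y⟩⟩

instance : One Heisenberg := ⟨⟨0, 0, 0⟩⟩

instance : Inv Heisenberg := ⟨fun g => ⟨-g.x, -g.y, -g.z + g.x * g.y⟩⟩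

@[simp] theorem mul_x (g h : Heisenberg) : (g * h).x = g.x + h.x := rfl
@[simp] theorem mul_y (g h : Heisenberg) : (g * h).y = g.y + h.y := rfl
@[simp] theorem mul_z (g h : Heisenberg) : (g * h).z = g.z + h.z + g.x * h.y := rfl
@[simp] theorem one_x : (1 : Heisenberg).x = 0 := rfl
@[simp] theorem one_y : (1 : Heisenberg).y = 0 := rfl
@[simp] theorem one_z : (1 : Heisenberg).z = 0 := rfl
@[simp] theorem inv_x (g : Heisenberg) : g⁻¹.x = -g.x := rfl
@[simp] theorem inv_y (g : Heisenberg) : g⁻¹.y = -g.y := rfl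
@[simp] theorem inv_z (g : Heisenberg) : g⁻¹.z = -g.z + g.x * g.y := rfl

instance : Group Heisenberg := Group.ofLeftAxioms
  (fun a b c => by ext <;> simp <;> ring) (fun a => by ext <;> simp) (fun a => by ext <;> simp)

/-- The first coordinate, as a homomorphism. -/
def xHom : Heisenberg →* Multiplicative ℤ := MonoidHom.mk' (fun g => Multiplicative.ofAdd g.x)
  fun _ _ => rfl

/-- The second coordinate, as a homomorphism. -/
def yHom : Heisenberg →* Multiplicative ℤ := MonoidHom.mk' (fun g => Multiplicative.ofAdd g.y)
  fun _ _ => rfl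

theorem x_mul_y_of_commute {g h : Heisenberg} (e : Commute g h) : g.x * h.y = h.x * g.y := by
  have := congrArg Heisenberg.z e.eq
  simp only [mul_z] at this
  linarith

end Heisenberg

open Classical in
/-- The exponent sums of commuting elements with respect to two non-adjacent vertices are linearly
dependent. -/
theorem ex_mul_ex_of_commute {a b : V} (hab : ¬ Γ.Adj a b) {g h : RAAG Γ} (e : Commute g h) :
    ex a g * ex b h = ex a h * ex b g := by
  by_cases hne : a = b
  · subst hne; ring
  -- Non-adjacency lets `a` and `b` go to the two standard generators; commuting in the Heisenberg
  -- group means that the determinant of the first two coordinates vanishes.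
  let θ : RAAG Γ →* Heisenberg :=
    lift (fun c => if c = a then ⟨1, 0, 0⟩ else if c = b then ⟨0, 1, 0⟩ else 1) (by
      intro c d hcd
      by_cases h1 : c = a
      · by_cases h2 : d = b
        · subst h1 h2; exact absurd hcd hab
        · have : d ≠ a := fun e => hcd.ne (h1.trans e.symm)
          simp [h2, this]
      · by_cases h2 : c = b
        · by_cases h3 : d = a
          · subst h2 h3; exact absurd hcd.symm hab
          · have : d ≠ b := fun e => hcd.ne (h2.trans e.symm)
            simp [h3, this]
        · simp [h1, h2])
  have hx : Heisenberg.xHom.comp θ = expHom Γ a := PresentedGroup.ext fun c => by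
    change Multiplicative.ofAdd (θ (gen Γ c)).x = Multiplicative.ofAdd (ex a (gen Γ c))
    rw [ex_gen]
    simp only [θ, lift_gen]
    split_ifs <;> rfl
  have hy : Heisenberg.yHom.comp θ = expHom Γ b := PresentedGroup.ext fun c => by
    change Multiplicative.ofAdd (θ (gen Γ c)).y = Multiplicative.ofAdd (ex b (gen Γ c))
    rw [ex_gen]
    simp only [θ, lift_gen]
    split_ifs with h1 h2 h2
    · exact absurd (h1.symm.trans h2) hne
    all_goals rfl
  have hx' : ∀ g, (θ g).x = ex a g := fun g => DFunLike.congr_fun hx g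
  have hy' : ∀ g, (θ g).y = ex b g := fun g => DFunLike.congr_fun hy g
  have := Heisenberg.x_mul_y_of_commute (e.map θ)
  rwa [hx', hy', hx', hy'] at this

end Exponent

/-! ### The action of a lift on the abelianization. -/

section Homology

variable {W : Type u} {V : Type v} {Λ : SimpleGraph W} {Γ : SimpleGraph V} {p : Λ →g Γ}

open Classical in
theorem ex_map [Fintype W] (c : V) (x : RAAG Λ) :
    ex c (map p x) = ∑ b with p b = c, ex b x := by
  have h := toAdd_eq_sum ((expHom Γ c).comp (map p)) x
  have h1 : ∀ b, (((expHom Γ c).comp (map p)) (gen Λ b)).toAdd = if p b = c then 1 else 0 := by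
    intro b
    change ex c (map p (gen Λ b)) = _
    rw [map, lift_gen, ex_gen]
  simp only [h1, mul_ite, mul_one, mul_zero] at h
  rw [Finset.sum_filter, ← h]
  rfl

open Classical in
/-- Two integral vectors on a covering graph that are linearly dependent at any two non-adjacent
vertices, and whose sums over the fibres are those of two distinct vertices, are concentrated on two
adjacent vertices. -/
theorem exists_concentrated [Fintype W] (hp : IsCovering p) {c d : V} (hcd : c ≠ d) {X Y : W → ℤ}
    (hXY : ∀ a b, ¬ Λ.Adj a b → X a * Y b = Y a * X b)
    (hX : ∀ e, ∑ b with p b = e, X b = if c = e then 1 else 0)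
    (hY : ∀ e, ∑ b with p b = e, Y b = if d = e then 1 else 0) :
    ∃ a b, p a = c ∧ p b = d ∧ Λ.Adj a b ∧ (∀ e, X e = if a = e then 1 else 0) ∧
      ∀ e, Y e = if b = e then 1 else 0 := by
  -- The fibre sums over `c` and `d` give some `e` whose pair `(X e, Y e)` is independent of that at
  -- `a`. If the pair at `b` were also nonzero, it would be parallel to that at `a`, making `e`
  -- adjacent to both `a` and `b`: two neighbours in one fibre.
  have hinj : ∀ a b, a ≠ b → p a = p b → ¬ (X a = 0 ∧ Y a = 0) → X b = 0 ∧ Y b = 0 := by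
    intro a b hab hpab ha
    by_contra hb
    have hnab : ¬ Λ.Adj a b := fun h => (p.map_adj h).ne hpab
    obtain ⟨e, he⟩ : ∃ e, X a * Y e ≠ Y a * X e := by
      by_contra! hc
      apply ha
      have h1 : X a * ∑ b with p b = c, Y b = Y a * ∑ b with p b = c, X b := by
        rw [Finset.mul_sum, Finset.mul_sum]
        exact Finset.sum_congr rfl fun b _ => hc b
      have h2 : X a * ∑ b with p b = d, Y b = Y a * ∑ b with p b = d, X b := by
        rw [Finset.mul_sum, Finset.mul_sum]
        exact Finset.sum_congr rfl fun b _ => hc b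
      rw [hX, hY, if_pos rfl, if_neg hcd.symm] at h1
      rw [hX, hY, if_pos rfl, if_neg hcd] at h2
      constructor <;> linarith
    have he' : X b * Y e ≠ Y b * X e := by
      intro hbe
      have h1 := hXY a b hnab
      have h2 : X b * (X a * Y e - Y a * X e) = 0 := by linear_combination X a * hbe + X e * h1
      have h3 : Y b * (X a * Y e - Y a * X e) = 0 := by linear_combination Y a * hbe + Y e * h1
      have h4 : X a * Y e - Y a * X e ≠ 0 := sub_ne_zero.2 he
      exact hb ⟨(mul_eq_zero.1 h2).resolve_right h4, (mul_eq_zero.1 h3).resolve_right h4⟩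
    have hae : Λ.Adj e a := by by_contra hn; exact he (hXY a e fun h => hn h.symm)
    have hbe : Λ.Adj e b := by by_contra hn; exact he' (hXY b e fun h => hn h.symm)
    exact hab ((hp.bijOn e).injOn hae hbe hpab)
  have hsum : ∀ a, ¬ (X a = 0 ∧ Y a = 0) →
      (X a = if c = p a then 1 else 0) ∧ (Y a = if d = p a then 1 else 0) := by
    intro a ha
    rw [← hX, ← hY, Finset.sum_eq_single a, Finset.sum_eq_single a]
    · exact ⟨rfl, rfl⟩
    · intro b hb hba
      exact (hinj a b hba.symm (by simpa using (Finset.mem_filter.1 hb).2.symm) ha).2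
    · simp
    · intro b hb hba
      exact (hinj a b hba.symm (by simpa using (Finset.mem_filter.1 hb).2.symm) ha).1
    · simp
  obtain ⟨a, ha, ha'⟩ : ∃ a, p a = c ∧ X a ≠ 0 := by
    by_contra! hc
    have := hX c
    rw [if_pos rfl, Finset.sum_eq_zero fun b hb => hc b (Finset.mem_filter.1 hb).2] at this
    omega
  obtain ⟨b, hb, hb'⟩ : ∃ b, p b = d ∧ Y b ≠ 0 := by
    by_contra! hc
    have := hY d
    rw [if_pos rfl, Finset.sum_eq_zero fun b hb => hc b (Finset.mem_filter.1 hb).2] at this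
    omega
  obtain ⟨ha1, ha2⟩ := hsum a fun h => ha' h.1
  obtain ⟨hb1, hb2⟩ := hsum b fun h => hb' h.2
  rw [ha, if_pos rfl] at ha1
  rw [ha, if_neg hcd.symm] at ha2
  rw [hb, if_neg hcd] at hb1
  rw [hb, if_pos rfl] at hb2
  refine ⟨a, b, ha, hb, ?_, fun e => ?_, fun e => ?_⟩
  · by_contra hn
    have := hXY a b hn
    rw [ha1, ha2, hb1, hb2] at this
    omega
  · split_ifs with h
    · rw [← h, ha1]
    · by_contra he
      have h1 := (hsum e fun h => he h.1).1
      have h2 : c = p e := by by_contra hn; exact he (by rw [h1, if_neg hn])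
      exact he (hinj a e h (ha.trans h2) fun h => ha' h.1).1
  · split_ifs with h
    · rw [← h, hb2]
    · by_contra he
      have h1 := (hsum e fun h => he h.2).2
      have h2 : d = p e := by by_contra hn; exact he (by rw [h1, if_neg hn])
      exact he (hinj b e h (hb.trans h2) fun h => hb' h.2).2

theorem map_gen (w : W) : map p (gen Λ w) = gen Γ (p w) := lift_gen _ _ _

/-- Every vertex `w` of the cover has a neighbour `u`, and the exponent vectors of `F w` and `F u`
satisfy the hypotheses of `exists_concentrated`: dependence comes from commutation, the fibre sums
from `f` preserving exponents. -/
theorem exists_deck_of_isLift [Finite W] (hp : IsCovering p) (hΓ : ∀ a, ¬ Γ.IsIsolated a)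
    {f : MulAut (RAAG Γ)} (hf : f ∈ PAut Γ) {F : MulAut (RAAG Λ)} (hF : IsLift p F f) :
    ∃ σ : Λ →g Λ, (∀ w, p (σ w) = p w) ∧ ∀ w e, ex e (F (gen Λ w)) = ex e (gen Λ (σ w)) := by
  classical
  cases nonempty_fintype W
  have key : ∀ w u, Λ.Adj w u → ∃ a b, p a = p w ∧ p b = p u ∧ Λ.Adj a b ∧
      (∀ e, ex e (F (gen Λ w)) = if a = e then 1 else 0) ∧
      ∀ e, ex e (F (gen Λ u)) = if b = e then 1 else 0 := by
    intro w u hwu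
    have hsum : ∀ w e, ∑ b with p b = e, ex b (F (gen Λ w)) = if p w = e then 1 else 0 := by
      intro w e
      rw [← ex_map, ← hF, ex_map_of_mem_PAut hf, map_gen, ex_gen]
    refine exists_concentrated hp (p.map_adj hwu).ne (fun a b hab => ?_) (hsum w) (hsum u)
    rw [ex_mul_ex_of_commute hab ((gen_commute hwu).map F), mul_comm]
  have hnbr : ∀ w, ∃ u, Λ.Adj w u := by
    intro w
    have : ∃ c, Γ.Adj (p w) c := by
      by_contra! hc
      exact hΓ (p w) (by simpa [SimpleGraph.IsIsolated] using hc)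
    obtain ⟨c, hc⟩ := this
    obtain ⟨u, hu, -⟩ := (hp.bijOn w).surjOn hc
    exact ⟨u, hu⟩
  have hex : ∀ w, ∃ a, p a = p w ∧ ∀ e, ex e (F (gen Λ w)) = if a = e then 1 else 0 := by
    intro w
    obtain ⟨u, hu⟩ := hnbr w
    obtain ⟨a, -, h1, -, -, h2, -⟩ := key w u hu
    exact ⟨a, h1, h2⟩
  choose σ hσ hσ' using hex
  have huniq : ∀ w a, (∀ e, ex e (F (gen Λ w)) = if a = e then 1 else 0) → a = σ w := by
    intro w a h
    have h1 := h a
    rw [hσ', if_pos rfl] at h1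
    by_contra hn
    rw [if_neg (Ne.symm hn)] at h1
    omega
  refine ⟨⟨σ, fun {w u} hwu => ?_⟩, hσ, fun w e => by rw [hσ', ex_gen]; rfl⟩
  obtain ⟨a, b, -, -, hab, h1, h2⟩ := key w u hwu
  rwa [huniq w a h1, huniq u b h2] at hab

theorem map_comp_eq {p : Λ →g Γ} {σ : Λ →g Λ} (h : ∀ w, p (σ w) = p w) (x : RAAG Λ) :
    map p (map σ x) = map p x := by
  have : (map p).comp (map σ) = map p := PresentedGroup.ext fun w => by
    change map p (map σ (gen Λ w)) = map p (gen Λ w)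
    rw [map_gen, map_gen, map_gen, h]
  exact DFunLike.congr_fun this x

/-- A lift of a conjugating automorphism can be chosen to act trivially on the abelianization. -/
theorem exists_isLift_ex_eq [Finite W] (hp : IsCovering p) (hΓ : ∀ a, ¬ Γ.IsIsolated a)
    {f : MulAut (RAAG Γ)} (hf : f ∈ PAut Γ) (hL : f ∈ LAut p) :
    ∃ F : MulAut (RAAG Λ), IsLift p F f ∧ ∀ w e, ex e (F (gen Λ w)) = ex e (gen Λ w) := by
  classical
  cases nonempty_fintype W
  obtain ⟨F, hF⟩ := hL
  obtain ⟨σ, hσ, hσ'⟩ := exists_deck_of_isLift hp hΓ hf hF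
  -- Identified vertices would have images with equal exponent vectors, and applying the inverse of
  -- `F` would equate the vectors of the two vertices themselves.
  have hinj : Function.Injective σ := by
    intro w u hwu
    by_contra hne
    let ψ : RAAG Λ →* Multiplicative ℤ := (expHom Λ w).comp (F⁻¹ : MulAut (RAAG Λ)).toMonoidHom
    have h1 : ∀ v, ex w (gen Λ v) = (ψ (gen Λ (σ v))).toAdd := by
      intro v
      have h2 : ex w (gen Λ v) = (ψ (F (gen Λ v))).toAdd := by
        change _ = ex w ((F⁻¹ : MulAut (RAAG Λ)) (F (gen Λ v)))
        rw [MulAut.inv_apply_self]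
      rw [h2, toAdd_eq_sum ψ (F (gen Λ v)), toAdd_eq_sum ψ (gen Λ (σ v))]
      simp only [hσ']
    have h2 := h1 w
    rw [hwu, ← h1, ex_gen_self, ex_gen_of_ne (Ne.symm hne)] at h2
    omega
  let e : Equiv.Perm W := Equiv.ofBijective σ (Finite.injective_iff_bijective.1 hinj)
  have hadj : ∀ (n : ℕ) w u, Λ.Adj w u → Λ.Adj ((e ^ n) w) ((e ^ n) u) := by
    intro n
    induction n with
    | zero => intro w u h; simpa using h
    | succ n ih =>
      intro w u h
      rw [pow_succ']
      exact σ.map_adj (ih w u h)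
  have hinv : ∀ w u, Λ.Adj w u → Λ.Adj (e.symm w) (e.symm u) := by
    intro w u h
    -- By finiteness the inverse permutation is a power of `e`, so it preserves adjacency too.
    have h1 : e⁻¹ = e ^ (orderOf e - 1) := by
      have := orderOf_pos e
      rw [inv_eq_iff_mul_eq_one, ← pow_succ', Nat.sub_add_cancel this, pow_orderOf_eq_one]
    have h2 := hadj (orderOf e - 1) w u h
    rw [← h1] at h2
    exact h2
  let τ : Λ →g Λ := ⟨e.symm, fun {w u} h => hinv w u h⟩
  have hστ : ∀ w, σ (τ w) = w := e.apply_symm_apply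
  have hτσ : ∀ w, τ (σ w) = w := e.symm_apply_apply
  let T : MulAut (RAAG Λ) := MonoidHom.toMulEquiv (map τ) (map σ)
    (PresentedGroup.ext fun w => by
      change map σ (map τ (gen Λ w)) = gen Λ w
      rw [map_gen, map_gen, hστ])
    (PresentedGroup.ext fun w => by
      change map τ (map σ (gen Λ w)) = gen Λ w
      rw [map_gen, map_gen, hτσ])
  refine ⟨F * T, fun x => ?_, fun w e => ?_⟩
  · have h1 : map p (map τ x) = map p x := map_comp_eq (fun w => by
      rw [← hσ (τ w), hστ]) x
    rw [← h1, hF]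
    rfl
  · change ex e (F (map τ (gen Λ w))) = _
    rw [map_gen, hσ', hστ]

end Homology

/-! ### Coset constraints imposed by a lift. -/

section Lift

open scoped Pointwise

variable {W : Type u} {V : Type v} {Λ : SimpleGraph W} {Γ : SimpleGraph V} {p : Λ →g Γ}

/-- Otherwise a nontrivial power of `x` would be conjugate into the link subgroup of `a`, where the
exponent of `c` vanishes. -/
theorem inv_mul_mem_para_of_conj_mem {a c : V} {x k l : RAAG Γ} (hc : ¬ Γ.Adj a c)
    (hx : ex c x ≠ 0) (hk : k⁻¹ * x * k ∈ para Γ {a}ᶜ) (hl : l⁻¹ * x * l ∈ para Γ {a}ᶜ) :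
    k⁻¹ * l ∈ para Γ {a}ᶜ := by
  by_contra h
  obtain ⟨n, g, hn, hg⟩ := exists_zpow_conj_mem hk (k := k⁻¹ * l)
    (by convert hl using 1; group) h
  have h1 := ex_eq_zero_of_mem_para (a := c) hc hg
  simp only [ex_mul, ex_inv, ex_zpow] at h1
  have h2 : n * ex c x = 0 := by linarith
  exact (mul_ne_zero hn hx) h2

/-- If `x` involved `a`, it would skewer a half-space of label `a`, and some `x ^ m * y ^ n` (up to
conjugating `y`) with `n ≠ 0` would be conjugate into the link subgroup of `a`. Its exponent of `c`
is a nonzero multiple of that of `y`. -/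
theorem CycRed.mem_para_of_commute {a c : V} {x y k : RAAG Γ} (hx : CycRed x)
    (hc : ¬ Γ.Adj a c) (hxy : Commute (k * x * k⁻¹) y)
    (hxe : ex c (k * x * k⁻¹) = 0) (hye : ex c y ≠ 0) : x ∈ para Γ {a}ᶜ := by
  by_contra h
  obtain ⟨K, hK, hxK⟩ := hx.exists_skewered h
  have h1 : Commute x (k⁻¹ * y * k) := by
    have h2 : Commute (k⁻¹ * (k * x * k⁻¹) * k⁻¹⁻¹) (k⁻¹ * y * k⁻¹⁻¹) :=
      (Commute.conj_iff _).2 hxy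
    simpa [mul_assoc] using h2
  obtain ⟨m, n, g, hn, hg⟩ := exists_zpow_mul_pow_conj_mem hK hxK h1
  have h1 := ex_eq_zero_of_mem_para (a := c) hc hg
  rw [ex_conj] at hxe
  simp only [ex_mul, ex_inv, ex_zpow, hxe] at h1
  have h2 : n * ex c y = 0 := by linarith
  exact (mul_ne_zero hn hye) h2

section

variable {F : MulAut (RAAG Λ)} {k x : W → RAAG Λ}

/-- Adjacent vertices outside the star of `a` have cyclically reduced images without the letter
`a`, up to conjugation by elements of the same coset. -/
theorem conj_mem_para_of_adj (hF : ∀ w e, ex e (F (gen Λ w)) = ex e (gen Λ w))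
    (hx : ∀ w, CycRed (x w)) (hkx : ∀ w, F (gen Λ w) = k w * x w * (k w)⁻¹) {a w u : W}
    (hwu : Λ.Adj w u) (hw : w ∉ star Λ a) (hu : u ∉ star Λ a) :
    x w ∈ para Λ {a}ᶜ ∧ (k w)⁻¹ * k u ∈ para Λ {a}ᶜ := by
  have hc : Commute (F (gen Λ w)) (F (gen Λ u)) := (gen_commute hwu).map F
  have aux : ∀ w u, Λ.Adj w u → u ∉ star Λ a → x w ∈ para Λ {a}ᶜ := by
    intro w u hwu hu
    refine (hx w).mem_para_of_commute (k := k w) (y := F (gen Λ u)) (c := u)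
      (fun h => hu (Or.inr h)) ?_ ?_ ?_
    · rw [← hkx]; exact (gen_commute hwu).map F
    · rw [← hkx, hF, ex_gen_of_ne hwu.ne]
    · rw [hF, ex_gen_self]; exact one_ne_zero
  have hxw := aux w u hwu hu
  have hxu := aux u w hwu.symm hw
  refine ⟨hxw, ?_⟩
  have h1 : (k w)⁻¹ * F (gen Λ w) * k w ∈ para Λ {a}ᶜ := by
    rw [hkx]; convert hxw using 1; group
  have h2 : (k u)⁻¹ * F (gen Λ u) * k u ∈ para Λ {a}ᶜ := by
    rw [hkx]; convert hxu using 1; group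
  -- Since the images commute, `F (gen Λ u) * k w` conjugates the image of `w` as `k w` does.
  -- Comparing the two shows that `k w` also conjugates the image of `u` into the subgroup avoiding
  -- `a`, and then `k w` can be compared with `k u`.
  have h3 : (F (gen Λ u) * k w)⁻¹ * F (gen Λ w) * (F (gen Λ u) * k w) ∈ para Λ {a}ᶜ := by
    have : (F (gen Λ u) * k w)⁻¹ * F (gen Λ w) * (F (gen Λ u) * k w) =
        (k w)⁻¹ * (F (gen Λ u))⁻¹ * (F (gen Λ w) * F (gen Λ u)) * k w := by group
    rw [this, hc.eq]
    convert h1 using 1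
    group
  have h4 := inv_mul_mem_para_of_conj_mem (c := w) (fun h => hw (Or.inr h))
    (by rw [hF, ex_gen_self]; exact one_ne_zero) h1 h3
  rw [← mul_assoc] at h4
  exact inv_mul_mem_para_of_conj_mem (c := u) (fun h => hu (Or.inr h))
    (by rw [hF, ex_gen_self]; exact one_ne_zero) h4 h2

theorem conj_mem_para_of_reachable (hF : ∀ w e, ex e (F (gen Λ w)) = ex e (gen Λ w))
    (hx : ∀ w, CycRed (x w)) (hkx : ∀ w, F (gen Λ w) = k w * x w * (k w)⁻¹) {a : W}
    {w u : ((star Λ a)ᶜ : Set W)} (h : (Λ.induce (star Λ a)ᶜ).Reachable w u) (hne : w ≠ u) :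
    x w ∈ para Λ {a}ᶜ ∧ (k w)⁻¹ * k u ∈ para Λ {a}ᶜ := by
  obtain ⟨q⟩ := h
  have aux : ∀ {w u : ((star Λ a)ᶜ : Set W)} (q : (Λ.induce (star Λ a)ᶜ).Walk w u),
      (k w)⁻¹ * k u ∈ para Λ {a}ᶜ := by
    intro w u q
    induction q with
    | nil => rw [inv_mul_cancel]; exact one_mem _
    | @cons w v u hadj _ ih =>
      have := mul_mem
        (conj_mem_para_of_adj hF hx hkx (a := a) (w := w.1) (u := v.1) hadj w.2 v.2).2 ih
      convert this using 1
      group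
  refine ⟨?_, aux q⟩
  cases q with
  | nil => exact absurd rfl hne
  | @cons _ v _ hadj _ => exact (conj_mem_para_of_adj hF hx hkx (a := a) hadj w.2 v.2).1

end

theorem map_mem_para {S : Set W} {T : Set V} (h : ∀ w ∈ S, p w ∈ T) {g : RAAG Λ}
    (hg : g ∈ para Λ S) : map p g ∈ para Γ T := by
  have : para Λ S ≤ (para Γ T).comap (map p) := by
    rw [para, Subgroup.closure_le]
    rintro _ ⟨w, hw, rfl⟩
    rw [SetLike.mem_coe, Subgroup.mem_comap, map_gen]
    exact gen_mem_para (h w hw)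
  exact this hg

/-- Suppose two vertices of the cover are connected outside the star of each vertex over `v`. Then a
liftable conjugating automorphism conjugates their images by elements of the same coset of the
subgroup generated by the vertices other than `v`. -/
theorem inv_mul_mem_para_of_reachable [Finite W] (hp : IsCovering p)
    (hΓ : ∀ a, ¬ Γ.IsIsolated a) {f : MulAut (RAAG Γ)} (hf : f ∈ PAut Γ) (hL : f ∈ LAut p)
    {v : V} {w u : W} (hw : p w ∉ star Γ v) (hu : p u ∉ star Γ v)
    (hwu : ∀ a, p a = v → ∃ (h₁ : w ∉ star Λ a) (h₂ : u ∉ star Λ a),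
      (Λ.induce (star Λ a)ᶜ).Reachable ⟨w, h₁⟩ ⟨u, h₂⟩)
    {g h : RAAG Γ} (hg : f (gen Γ (p w)) = g * gen Γ (p w) * g⁻¹)
    (hh : f (gen Γ (p u)) = h * gen Γ (p u) * h⁻¹) : g⁻¹ * h ∈ para Γ {v}ᶜ := by
  -- A component consisting of a single vertex has no edge to show that `x w` avoids `a`, so equal
  -- vertices are treated directly.
  by_cases hne : w = u
  · subst hne
    refine para_mono ?_ (inv_mul_mem_para_star (hg.symm.trans hh))
    intro b hb e
    subst e
    rcases hb with e | e
    · exact hw (Or.inl e.symm)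
    · exact hw (Or.inr (SimpleGraph.Adj.symm e))
  obtain ⟨F, hFl, hF⟩ := exists_isLift_ex_eq hp hΓ hf hL
  choose k x hx hkx using fun w => exists_cycRed (F (gen Λ w))
  -- Avoiding each vertex over `v` separately means avoiding the whole fibre, hence avoiding `v`
  -- after projection.
  have hinter : ∀ g : RAAG Λ, (∀ a : {a // p a = v}, g ∈ para Λ {a.1}ᶜ) →
      map p g ∈ para Γ {v}ᶜ := by
    intro g hg
    refine map_mem_para ?_ (mem_para_iInter hg)
    intro b hb e
    exact Set.mem_iInter.1 hb ⟨b, e⟩ rfl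
  have key : ∀ w, p w ∉ star Γ v → (∀ a, p a = v → x w ∈ para Λ {a}ᶜ) → ∀ g : RAAG Γ,
      f (gen Γ (p w)) = g * gen Γ (p w) * g⁻¹ → g⁻¹ * map p (k w) ∈ para Γ {v}ᶜ := by
    intro w hw hxw g hg
    refine inv_mul_mem_para_of_conj_mem (x := f (gen Γ (p w))) (c := p w)
      (fun h => hw (Or.inr h)) ?_ ?_ ?_
    · rw [ex_map_of_mem_PAut hf, ex_gen_self]; exact one_ne_zero
    · rw [hg]
      convert gen_mem_para (Γ := Γ) (S := {v}ᶜ) (a := p w) (fun e => hw (Or.inl e)) using 1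
      group
    · rw [← map_gen, hFl, hkx, map_mul, map_mul, map_inv]
      convert hinter (x w) (fun a => hxw a.1 a.2) using 1
      group
  have hmw : ∀ a, p a = v → x w ∈ para Λ {a}ᶜ ∧ (k w)⁻¹ * k u ∈ para Λ {a}ᶜ := by
    intro a ha
    obtain ⟨h₁, h₂, hr⟩ := hwu a ha
    exact conj_mem_para_of_reachable hF hx hkx hr (fun e => hne (congrArg Subtype.val e))
  have hmu : ∀ a, p a = v → x u ∈ para Λ {a}ᶜ := by
    intro a ha
    obtain ⟨h₁, h₂, hr⟩ := hwu a ha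
    exact (conj_mem_para_of_reachable hF hx hkx hr.symm
      (fun e => hne (congrArg Subtype.val e).symm)).1
  have h1 := key w hw (fun a ha => (hmw a ha).1) g hg
  have h2 := hinter _ fun a => (hmw a.1 a.2).2
  have h3 := key u hu hmu h hh
  have := mul_mem (mul_mem h1 h2) (inv_mem h3)
  rw [map_mul, map_inv] at this
  convert this using 1
  group

end Lift

/-! ### Connectivity in the cover outside stars. -/

section Covering

variable {W : Type u} {V : Type v} {Λ : SimpleGraph W} {Γ : SimpleGraph V} {p : Λ →g Γ}

/-- `w` and `y` are connected outside the star of `b`. -/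
def ReachOff (Λ : SimpleGraph W) (b w y : W) : Prop :=
  ∃ (h₁ : w ∉ star Λ b) (h₂ : y ∉ star Λ b), (Λ.induce (star Λ b)ᶜ).Reachable ⟨w, h₁⟩ ⟨y, h₂⟩

theorem ReachOff.symm {b w y : W} (h : ReachOff Λ b w y) : ReachOff Λ b y w :=
  let ⟨h₁, h₂, h⟩ := h
  ⟨h₂, h₁, h.symm⟩

theorem ReachOff.trans {b w y z : W} (h : ReachOff Λ b w y) (h' : ReachOff Λ b y z) :
    ReachOff Λ b w z :=
  let ⟨h₁, _, h⟩ := h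
  let ⟨_, h₂, h'⟩ := h'
  ⟨h₁, h₂, h.trans h'⟩

theorem ReachOff.of_adj {b w y : W} (h₁ : w ∉ star Λ b) (h₂ : y ∉ star Λ b) (h : Λ.Adj w y) :
    ReachOff Λ b w y :=
  ⟨h₁, h₂, SimpleGraph.Adj.reachable (G := Λ.induce (star Λ b)ᶜ) h⟩

theorem mem_star_iso (σ : Λ ≃g Λ) {b w : W} : σ w ∈ star Λ (σ b) ↔ w ∈ star Λ b := by
  refine or_congr σ.injective.eq_iff ?_
  exact σ.map_adj_iff

theorem ReachOff.map (σ : Λ ≃g Λ) {b w y : W} (h : ReachOff Λ b w y) :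
    ReachOff Λ (σ b) (σ w) (σ y) := by
  obtain ⟨h₁, h₂, h⟩ := h
  let τ : Λ.induce (star Λ b)ᶜ →g Λ.induce (star Λ (σ b))ᶜ :=
    ⟨fun x => ⟨σ x.1, fun hx => x.2 ((mem_star_iso σ).1 hx)⟩, fun {x y} hxy =>
      (σ.map_adj_iff (v := x.1) (w := y.1)).2 hxy⟩
  exact ⟨_, _, h.map τ⟩

/-- In the subgraph of the cover outside the preimage of the star of `v`, the component of `w`
contains a neighbour of the link of `a`. -/
inductive Touches (p : Λ →g Γ) (v : V) (a : W) : W → Prop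
  | base {w u : W} : p w ∉ star Γ v → Λ.Adj w u → Λ.Adj u a → Touches p v a w
  | step {w y : W} : p w ∉ star Γ v → Λ.Adj w y → Touches p v a y → Touches p v a w

theorem Touches.notMem_star {v : V} {a w : W} (h : Touches p v a w) : p w ∉ star Γ v := by
  cases h <;> assumption

theorem Touches.map {v : V} {a w : W} (h : Touches p v a w) {σ : Λ ≃g Λ} (hσ : IsDeck p σ) :
    Touches p v (σ a) (σ w) := by
  induction h with
  | base h1 h2 h3 =>
    exact .base (by rwa [hσ]) (σ.map_adj_iff.2 h2) (σ.map_adj_iff.2 h3)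
  | step h1 h2 _ ih => exact .step (by rwa [hσ]) (σ.map_adj_iff.2 h2) ih

theorem notMem_star_of_map_notMem {v : V} {b w : W} (hb : p b = v) (hw : p w ∉ star Γ v) :
    w ∉ star Λ b := by
  rintro (rfl | h)
  · exact hw (Or.inl hb)
  · exact hw (Or.inr (hb ▸ p.map_adj h))

theorem notMem_star_of_fibre {a b : W} (hab : p a = p b) (hne : a ≠ b) : a ∉ star Λ b := by
  rintro (rfl | h)
  · exact hne rfl
  · exact (p.map_adj h).ne hab.symm

theorem IsCovering.eq_of_adj (hp : IsCovering p) {a b c : W} (hab : p a = p b) (ha : Λ.Adj c a)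
    (hb : Λ.Adj c b) : a = b := (hp.bijOn c).injOn ha hb hab

/-- The path through the component into the link of `a` and on to `a` avoids the star of `b`: its
link vertex is already adjacent to `a`, and a covering allows it only one neighbour over `v`. -/
theorem Touches.reachOff (hp : IsCovering p) {v : V} {a b w : W} (ha : p a = v) (hb : p b = v)
    (hab : a ≠ b) (h : Touches p v a w) : ReachOff Λ b w a := by
  have ha' : a ∉ star Λ b := notMem_star_of_fibre (ha.trans hb.symm) hab
  induction h with
  | @base w u h1 h2 h3 =>
    have hu : u ∉ star Λ b := by
      rintro (rfl | h)
      · exact (p.map_adj h3).ne (hb.trans ha.symm)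
      · exact hab (hp.eq_of_adj (ha.trans hb.symm) h3 (SimpleGraph.Adj.symm h))
    exact (ReachOff.of_adj (notMem_star_of_map_notMem hb h1) hu h2).trans
      (ReachOff.of_adj hu ha' h3)
  | step h1 h2 h3 ih =>
    exact (ReachOff.of_adj (notMem_star_of_map_notMem hb h1)
      (notMem_star_of_map_notMem hb h3.notMem_star) h2).trans ih

theorem Touches.reachable {v : V} {a w : W} (h : Touches p v a w) : Λ.Reachable w a := by
  induction h with
  | base _ h2 h3 => exact h2.reachable.trans h3.reachable
  | step _ h2 _ ih => exact h2.reachable.trans ih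

/-- A vertex at maximal distance from `z` in its fibre does not separate `z` from the other vertices
of the fibre. -/
theorem reachOff_of_dist_le (hp : IsCovering p) {z m x : W} (hx : p x = p m) (hxm : x ≠ m)
    (hzx : Λ.Reachable z x) (hd : Λ.dist z x ≤ Λ.dist z m) : ReachOff Λ m z x := by
  classical
  obtain ⟨q, hq⟩ := hzx.exists_walk_length_eq_dist
  -- A geodesic to `x` meeting the star of `m` does so at most one step before its end, as `m` is no
  -- closer to `z`; then `x` would equal `m` or be adjacent to it, or share a neighbour with it.
  have key : ∀ y ∈ q.support, y ∈ (star Λ m)ᶜ := by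
    intro y hy hym
    have h1 := congrArg SimpleGraph.Walk.length (q.take_spec hy)
    rw [SimpleGraph.Walk.length_append, hq] at h1
    rcases hym with rfl | h
    · have h2 := SimpleGraph.dist_le (q.takeUntil y hy)
      exact hxm (SimpleGraph.Walk.eq_of_length_eq_zero (p := q.dropUntil y hy) (by omega)).symm
    · have h' : Λ.Adj y m := SimpleGraph.Adj.symm h
      have h2 := SimpleGraph.dist_le ((q.takeUntil y hy).concat h')
      rw [SimpleGraph.Walk.length_concat] at h2
      have h3 : (q.dropUntil y hy).length = 0 ∨ (q.dropUntil y hy).length = 1 := by omega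
      rcases h3 with h3 | h3
      · obtain rfl := SimpleGraph.Walk.eq_of_length_eq_zero h3
        exact (p.map_adj h').ne hx
      · exact hxm (hp.eq_of_adj hx (SimpleGraph.Walk.adj_of_length_eq_one h3) h')
  exact ⟨key z q.start_mem_support, key x q.end_mem_support, ⟨q.induce _ key⟩⟩

/-- The star of a vertex in a fibre of a regular covering does not separate the other vertices of
the fibre. -/
theorem reachOff_of_fibre [Finite W] (hp : IsRegularCovering p) {x y z : W} (hx : p x = p z)
    (hy : p y = p z) (hxz : x ≠ z) (hyz : y ≠ z) (hzx : Λ.Reachable z x) (hzy : Λ.Reachable z y) :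
    ReachOff Λ z x y := by
  -- Choose `m` farthest from `z` within the fibre; its star does not separate `z` from the other
  -- fibre vertices in the component. A deck transformation taking `m` to `z` transports this to the
  -- star of `z`.
  obtain ⟨m, ⟨hm, hzm⟩, hmax⟩ := Set.exists_max_image {a | p a = p z ∧ Λ.Reachable z a}
    (Λ.dist z) (Set.toFinite _) ⟨z, rfl, SimpleGraph.Reachable.refl _⟩
  obtain ⟨σ, hσ, hσm⟩ := hp.transitive m z hm
  have hσz : σ.symm z = m := by rw [← hσm, RelIso.symm_apply_apply]
  have aux : ∀ x, p x = p z → x ≠ z → Λ.Reachable z x → ReachOff Λ m z (σ.symm x) := by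
    intro x hx hxz hzx
    have h1 : p (σ.symm x) = p z := by
      rw [← hx, ← hσ (σ.symm x), RelIso.apply_symm_apply]
    have h2 : Λ.Reachable z (σ.symm x) := by
      have := hzx.map σ.symm.toHom
      refine hzm.trans ?_
      rw [← hσz]
      exact this
    refine reachOff_of_dist_le hp.toIsCovering (h1.trans hm.symm) ?_ h2 (hmax _ ⟨h1, h2⟩)
    rintro h
    apply hxz
    rw [← hσm, ← h, RelIso.apply_symm_apply]
  have := ((aux x hx hxz hzx).symm.trans (aux y hy hyz hzy)).map σ
  rwa [hσm, RelIso.apply_symm_apply, RelIso.apply_symm_apply] at this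

/-- The component of `w` outside the preimage of the star of `v` touches the links of two distinct
vertices over `v`. -/
def Straddles (p : Λ →g Γ) (v : V) (w : W) : Prop :=
  ∃ a b, p a = v ∧ p b = v ∧ a ≠ b ∧ Touches p v a w ∧ Touches p v b w

/-- Translate `u` so that both components touch `a₁`. Outside the star of any other fibre vertex
they are joined through `a₁`; outside the star of `a₁` itself they are joined through their second
touched vertices, which `reachOff_of_fibre` connects. -/
theorem Straddles.exists_reachOff [Finite W] (hp : IsRegularCovering p) {v : V} {w u : W}
    (hw : Straddles p v w) (hu : Straddles p v u) :
    ∃ u', p u' = p u ∧ ∀ a, p a = v → ReachOff Λ a w u' := by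
  obtain ⟨a₁, a₂, ha₁, ha₂, hne, h1, h2⟩ := hw
  obtain ⟨b₁, b₂, hb₁, hb₂, hne', h3, h4⟩ := hu
  obtain ⟨σ, hσ, hσb⟩ := hp.transitive b₁ a₁ (hb₁.trans ha₁.symm)
  have h5 := h3.map hσ
  have h6 := h4.map hσ
  rw [hσb] at h5
  have hb : p (σ b₂) = v := by rw [hσ, hb₂]
  have hne'' : σ b₂ ≠ a₁ := fun e => hne' (σ.injective (hσb.trans e.symm))
  have hp' := hp.toIsCovering
  refine ⟨σ u, hσ u, fun a ha => ?_⟩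
  by_cases haa : a = a₁
  · subst haa
    refine (h2.reachOff hp' ha₂ ha hne.symm).trans
      (ReachOff.trans ?_ (h6.reachOff hp' hb ha hne'').symm)
    exact reachOff_of_fibre hp (ha₂.trans ha.symm) (hb.trans ha.symm) hne.symm hne''
      (h1.reachable.symm.trans h2.reachable) (h5.reachable.symm.trans h6.reachable)
  · exact (h1.reachOff hp' ha₁ ha (Ne.symm haa)).trans (h5.reachOff hp' ha₁ ha (Ne.symm haa)).symm

end Covering

/-! ### Lifting partial conjugations, and the final induction. -/

section Liftable

variable {W : Type u} {V : Type v} {Λ : SimpleGraph W} {Γ : SimpleGraph V} {p : Λ →g Γ}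

open Classical in
/-- The endomorphism conjugating each vertex `w ∈ C` by `g w`. -/
noncomputable def multiConj (C : Set V) (g : V → RAAG Γ)
    (h1 : ∀ b c, Γ.Adj b c → b ∈ C → c ∈ C → g b = g c)
    (h2 : ∀ b c, Γ.Adj b c → b ∈ C → c ∉ C → Commute (g b) (gen Γ c)) : RAAG Γ →* RAAG Γ :=
  lift (fun b => if b ∈ C then g b * gen Γ b * (g b)⁻¹ else gen Γ b) (by
    intro b c hbc
    have key : ∀ b c, Γ.Adj b c → b ∈ C → c ∉ C →
        Commute (g b * gen Γ b * (g b)⁻¹) (gen Γ c) := fun b c h hb hc =>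
      ((h2 b c h hb hc).mul_left (gen_commute h)).mul_left (h2 b c h hb hc).inv_left
    split_ifs with hb hc hc
    · rw [h1 b c hbc hb hc]
      exact (Commute.conj_iff _).2 (gen_commute hbc)
    · exact key b c hbc hb hc
    · exact (key c b hbc.symm hc hb).symm
    · exact gen_commute hbc)

theorem multiConj_gen_of_mem {C : Set V} {g : V → RAAG Γ}
    (h1 : ∀ b c, Γ.Adj b c → b ∈ C → c ∈ C → g b = g c)
    (h2 : ∀ b c, Γ.Adj b c → b ∈ C → c ∉ C → Commute (g b) (gen Γ c)) {b : V} (hb : b ∈ C) :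
    multiConj C g h1 h2 (gen Γ b) = g b * gen Γ b * (g b)⁻¹ := by
  rw [multiConj, lift_gen, if_pos hb]

theorem multiConj_gen_of_notMem {C : Set V} {g : V → RAAG Γ}
    (h1 : ∀ b c, Γ.Adj b c → b ∈ C → c ∈ C → g b = g c)
    (h2 : ∀ b c, Γ.Adj b c → b ∈ C → c ∉ C → Commute (g b) (gen Γ c)) {b : V} (hb : b ∉ C) :
    multiConj C g h1 h2 (gen Γ b) = gen Γ b := by
  rw [multiConj, lift_gen, if_neg hb]

/-- Conjugation of each vertex `w ∈ C` by a vertex `c w ∉ C` is an automorphism if `c` is locally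
constant and `c w` commutes with the neighbours of `w` outside `C`. -/
theorem exists_multiConj (C : Set V) (c : V → V) (hc : ∀ w, c w ∉ C)
    (h1 : ∀ w u, Γ.Adj w u → w ∈ C → u ∈ C → c w = c u)
    (h2 : ∀ w u, Γ.Adj w u → w ∈ C → u ∉ C → Commute (gen Γ (c w)) (gen Γ u)) :
    ∃ F : MulAut (RAAG Γ),
      (∀ w ∈ C, F (gen Γ w) = gen Γ (c w) * gen Γ w * (gen Γ (c w))⁻¹) ∧
      ∀ w ∉ C, F (gen Γ w) = gen Γ w := by
  let P := multiConj C (fun w => gen Γ (c w)) (fun w u h hw hu => by rw [h1 w u h hw hu]) h2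
  let Q := multiConj C (fun w => (gen Γ (c w))⁻¹) (fun w u h hw hu => by rw [h1 w u h hw hu])
    (fun w u h hw hu => (h2 w u h hw hu).inv_left)
  have hP : ∀ w ∈ C, P (gen Γ w) = gen Γ (c w) * gen Γ w * (gen Γ (c w))⁻¹ :=
    fun w hw => multiConj_gen_of_mem _ _ hw
  have hP' : ∀ w ∉ C, P (gen Γ w) = gen Γ w := fun w hw => multiConj_gen_of_notMem _ _ hw
  have hQ : ∀ w ∈ C, Q (gen Γ w) = (gen Γ (c w))⁻¹ * gen Γ w * (gen Γ (c w))⁻¹⁻¹ :=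
    fun w hw => multiConj_gen_of_mem _ _ hw
  have hQ' : ∀ w ∉ C, Q (gen Γ w) = gen Γ w := fun w hw => multiConj_gen_of_notMem _ _ hw
  refine ⟨MonoidHom.toMulEquiv P Q (PresentedGroup.ext fun w => ?_)
    (PresentedGroup.ext fun w => ?_), hP, hP'⟩
  · change Q (P (gen Γ w)) = gen Γ w
    by_cases hw : w ∈ C
    · rw [hP w hw, map_mul, map_mul, map_inv, hQ' _ (hc w), hQ w hw]; group
    · rw [hP' w hw, hQ' w hw]
  · change P (Q (gen Γ w)) = gen Γ w
    by_cases hw : w ∈ C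
    · rw [hQ w hw]
      simp only [map_mul, map_inv, hP' _ (hc w), hP w hw]
      group
    · rw [hQ' w hw, hP' w hw]

/-- A partial conjugation whose support meets no straddling component is liftable. -/
theorem partialConj_mem_LAut_of_not_straddles (hp : IsCovering p) {v : V} {C : Set V}
    (hC : IsUnionOfComponents Γ v C) (hno : ∀ w, p w ∈ C → ¬ Straddles p v w) :
    partialConj v C hC ∈ LAut p := by
  classical
  obtain ⟨a₀, ha₀⟩ := hp.surjective v
  -- Over `C` a component touches at most one vertex over `v`, and this is its conjugator. If it
  -- touches none, no commutation constraint arises and any vertex `a₀` over `v` serves.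
  let pick : Set W → W := fun A => if h : A.Nonempty then h.some else a₀
  let A : W → Set W := fun w => {a | p a = v ∧ Touches p v a w}
  have hAv : ∀ w, p (pick (A w)) = v := by
    intro w
    by_cases h : (A w).Nonempty
    · simp only [pick, dif_pos h]; exact h.some_mem.1
    · simp only [pick, dif_neg h]; exact ha₀
  have hvC : v ∉ C := fun h => hC.notMem_star h (Set.mem_insert _ _)
  obtain ⟨F, hF, hF'⟩ := exists_multiConj (Γ := Λ) (p ⁻¹' C) (fun w => pick (A w))
    (fun w h => hvC (by rwa [Set.mem_preimage, hAv] at h))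
    (fun w u hwu hw hu => by
      have : A w = A u := by
        ext a
        exact and_congr_right fun _ => ⟨fun h => .step (hC.notMem_star hu) hwu.symm h,
          fun h => .step (hC.notMem_star hw) hwu h⟩
      simp only [this])
    (fun w u hwu hw hu => by
      have hus : p u ∈ star Γ v := by
        by_contra h
        exact hu (hC.mem_of_adj hw (p.map_adj hwu) h)
      have huv : Γ.Adj v (p u) := by
        rcases hus with e | e
        · exact absurd (Or.inr (e ▸ (p.map_adj hwu).symm)) (hC.notMem_star hw)
        · exact e
      obtain ⟨a, hua, ha⟩ := (hp.bijOn u).surjOn huv.symm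
      have haA : a ∈ A w := ⟨ha, .base (hC.notMem_star hw) hwu hua⟩
      have hne : (A w).Nonempty := ⟨a, haA⟩
      have hpick : pick (A w) ∈ A w := by
        simp only [pick, dif_pos hne]; exact hne.some_mem
      have : pick (A w) = a := by
        by_contra hn
        exact hno w hw ⟨_, _, hpick.1, ha, hn, hpick.2, haA.2⟩
      rw [this]
      exact gen_commute (SimpleGraph.Adj.symm hua))
  refine ⟨F, fun x => ?_⟩
  have h : (partialConj v C hC).toMonoidHom.comp (map p) = (map p).comp F.toMonoidHom :=
    PresentedGroup.ext fun w => by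
      change partialConj v C hC (map p (gen Λ w)) = map p (F (gen Λ w))
      rw [map_gen]
      by_cases hw : p w ∈ C
      · rw [partialConj_gen_of_mem hC hw, hF w hw, map_mul, map_mul, map_inv, map_gen, map_gen,
          hAv]
      · rw [partialConj_gen_of_notMem hC hw, hF' w hw, map_gen]
  exact DFunLike.congr_fun h x

theorem conj_mem_LAut (x : RAAG Λ) : MulAut.conj (map p x) ∈ LAut p :=
  ⟨MulAut.conj x, fun y => by simp⟩

theorem partialConj_mul_compl {v : V} {C : Set V} (hC : IsUnionOfComponents Γ v C)
    (hC' : IsUnionOfComponents Γ v {w | w ∉ star Γ v ∧ w ∉ C}) :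
    partialConj v C hC * partialConj v _ hC' = MulAut.conj (gen Γ v) := by
  have hv : v ∉ C := fun h => hC.notMem_star h (Set.mem_insert _ _)
  have h : (partialConj v C hC * partialConj v _ hC').toMonoidHom =
      (MulAut.conj (gen Γ v)).toMonoidHom := PresentedGroup.ext fun w => by
    change partialConj v C hC (partialConj v _ hC' (gen Γ w)) = MulAut.conj (gen Γ v) (gen Γ w)
    rw [MulAut.conj_apply]
    by_cases hw : w ∈ C
    · rw [partialConj_gen_of_notMem hC' (fun h => h.2 hw), partialConj_gen_of_mem hC hw]
    · by_cases hws : w ∈ star Γ v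
      · rw [partialConj_gen_of_notMem hC' (fun h => h.1 hws), partialConj_gen_of_notMem hC hw,
          ← (commute_of_mem_para_star (gen_mem_para hws)).eq, mul_inv_cancel_right]
      · rw [partialConj_gen_of_mem hC' ⟨hws, hw⟩, map_mul, map_mul, map_inv,
          partialConj_gen_of_notMem hC hw, partialConj_gen_of_notMem hC hv]
  exact MulEquiv.ext fun x => DFunLike.congr_fun h x

/-- The complementary partial conjugation meets no straddling component, hence lifts. Its product
with the given one is conjugation by `v`, which lifts to conjugation by a vertex over `v`. -/
theorem partialConj_mem_LAut_of_straddles (hp : IsCovering p) {v : V} {C : Set V}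
    (hC : IsUnionOfComponents Γ v C) (hall : ∀ w, Straddles p v w → p w ∈ C) :
    partialConj v C hC ∈ LAut p := by
  have hC' : IsUnionOfComponents Γ v {w | w ∉ star Γ v ∧ w ∉ C} :=
    isUnionOfComponents_of_closed (fun w hw => hw.1) fun w hw u hu hwu =>
      ⟨hu, fun h => hw.2 (hC.mem_of_adj h hwu.symm hw.1)⟩
  have h1 := partialConj_mem_LAut_of_not_straddles hp hC' fun w hw hs => hw.2 (hall w hs)
  obtain ⟨a, rfl⟩ := hp.surjective v
  have h2 := conj_mem_LAut (p := p) (gen Λ a)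
  rw [map_gen, ← partialConj_mul_compl hC hC'] at h2
  exact (Subgroup.mul_mem_cancel_right _ h1).1 h2

/-- The partial conjugation that simplifies a liftable conjugating automorphism is liftable. -/
theorem partialConj_mem_LAut [Finite W] (hp : IsRegularCovering p) (hΓ : ∀ a, ¬ Γ.IsIsolated a)
    {f : MulAut (RAAG Γ)} (hf : f ∈ LPAut p) {v : V} {C : Set V}
    (hC : IsUnionOfComponents Γ v C) {K : Set (RAAG Γ)} (hK : K ∈ halfspaces Γ v)
    (hmem : ∀ w g, f (gen Γ w) = g * gen Γ w * g⁻¹ → (w ∈ C ↔ w ∉ star Γ v ∧ g ∈ K)) :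
    partialConj v C hC ∈ LAut p := by
  by_cases hno : ∀ w, p w ∈ C → ¬ Straddles p v w
  · exact partialConj_mem_LAut_of_not_straddles hp.toIsCovering hC hno
  · push Not at hno
    obtain ⟨w, hw, hws⟩ := hno
    -- One straddling component over `C` pulls in all others: their conjugators lie in one coset of
    -- `⟨Γ \ v⟩`, so they are on the same side of the wall bounding `K`.
    refine partialConj_mem_LAut_of_straddles hp.toIsCovering hC fun u hus => ?_
    obtain ⟨u', hu', hr⟩ := hws.exists_reachOff hp hus
    have hu : p u ∉ star Γ v := by obtain ⟨_, _, -, -, -, h, -⟩ := hus; exact h.notMem_star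
    obtain ⟨g, hg⟩ := isConj_iff.1 (hf.2 (p w))
    obtain ⟨h, hh⟩ := isConj_iff.1 (hf.2 (p u))
    have h1 := inv_mul_mem_para_of_reachable hp.toIsCovering hΓ hf.2 hf.1 (w := w) (u := u')
      (hC.notMem_star hw) (by rwa [hu']) hr hg.symm (by rw [hu']; exact hh.symm)
    have h2 := mul_mem_halfspace_iff hK (by simp) h1 (z := g)
    rw [mul_inv_cancel_left] at h2
    exact (hmem _ _ hh.symm).2 ⟨hu, h2.2 ((hmem _ _ hg.symm).1 hw).2⟩

/-- Descent on the total length of the minimal conjugators; liftability of each reducing partial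
conjugation keeps the composite inside `LPAut p`. -/
theorem mem_closure_of_mem_LPAut [Finite W] [Finite V] (hp : IsRegularCovering p)
    (hΓ : ∀ a, ¬ Γ.IsIsolated a) {f : MulAut (RAAG Γ)} (hf : f ∈ LPAut p) :
    f ∈ Subgroup.closure {f : MulAut (RAAG Γ) | f ∈ LAut p ∧ IsPartialConj f} := by
  cases nonempty_fintype V
  induction hn : ∑ w, cost f w using Nat.strong_induction_on generalizing f with
  | _ n ih =>
    by_cases hne : f = 1
    · rw [hne]; exact one_mem _
    obtain ⟨a, C, hC, K, hK, hmem, P, hP, hle, w, hlt⟩ := exists_reduction hf.2 hne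
    have hL := partialConj_mem_LAut hp hΓ hf hC hK hmem
    have hPC : partialConj a C hC ∈
        Subgroup.closure {f : MulAut (RAAG Γ) | f ∈ LAut p ∧ IsPartialConj f} :=
      Subgroup.subset_closure ⟨hL, a, C, hC, rfl⟩
    have hPL : partialConj a C hC ∈ LPAut p := ⟨hL, partialConj_mem_PAut hC⟩
    have hP1 : P ∈ Subgroup.closure {f : MulAut (RAAG Γ) | f ∈ LAut p ∧ IsPartialConj f} ∧
        P ∈ LPAut p := by
      rcases hP with rfl | rfl
      · exact ⟨hPC, hPL⟩
      · exact ⟨inv_mem hPC, inv_mem hPL⟩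
    have hsum : ∑ w, cost (f * P) w < ∑ w, cost f w :=
      Finset.sum_lt_sum (fun w _ => hle w) ⟨w, Finset.mem_univ _, hlt⟩
    exact (Subgroup.mul_mem_cancel_right _ hP1.1).1
      (ih _ (hn ▸ hsum) (mul_mem hf hP1.2) rfl)

end Liftable

end RAAG

theorem mainTheorem2 {W V : Type*} [Finite W] [Finite V] {Λ : SimpleGraph W} {Γ : SimpleGraph V}
    (p : Λ →g Γ) (hp : RAAG.IsRegularCovering p) (hΓ : ∀ a, ¬ Γ.IsIsolated a) :
    Subgroup.closure {f : MulAut (RAAG Γ) | f ∈ RAAG.LAut p ∧ RAAG.IsPartialConj f} =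
      RAAG.LPAut p := by
  refine le_antisymm ((Subgroup.closure_le _).2 ?_) fun f hf =>
    RAAG.mem_closure_of_mem_LPAut hp hΓ hf
  rintro f ⟨hf, a, C, hC, rfl⟩
  exact ⟨hf, RAAG.partialConj_mem_PAut hC⟩
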